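/- Let $\kappa>0$, $1<\gamma<3$, $d\ge 1$ and $A_1,\dots,A_d>0$. Put $\theta=\frac{\gamma-1}{2}$, $a_\gamma=\frac{2\sqrt{\gamma\kappa}}{\gamma-1}$ and $D=\{(\rho,u)\in\mathbb R^2 : \rho>0 \text{ or } \rho=u=0\}$, and consider the isentropic gas equations $$\partial_t\rho+\partial_x(\rho u)=0,\qquad \partial_t(\rho u)+\partial_x(\rho u^2+\kappa\rho^\gamma)=0,$$ with characteristic speeds $\lambda_{1}=u-\sqrt{\kappa\gamma}\,\rho^\theta$, $\lambda_2=u+\sqrt{\kappa\gamma}\,\rho^\theta$ and Riemann invariants $\omega_{1}=u-a_\gamma\rho^\theta$, $\omega_2=u+a_\gamma\rho^\theta$. For $U_l,U_r\in D$, the Lax solution of the Riemann problem with left state $U_l$ and right state $U_r$ is the self-similar function $(t,x)\mapsto V(x/t)\in D$ consisting of constant states separated by a 1-wave followed by a 2-wave. Here an $i$-wave between states of positive density is either a centered $i$-rarefaction wave ($\lambda_i(V(\xi))=\xi$ in the fan, with $\omega_2$ constant if $i=1$ and $\omega_1$ constant if $i=2$; possibly trivial) or a shock satisfying the Rankine--Hugoniot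 conditions and the Lax entropy inequalities. If $U_l$ or $U_r$ is the vacuum $(0,0)$, or if $\omega_2(U_l)\le\omega_1(U_r)$, the 1-wave is a rarefaction from $U_l$ to vacuum (absent if $U_l=(0,0)$), the 2-wave is a rarefaction from vacuum to $U_r$ (absent if $U_r=(0,0)$), and $V=(0,0)$ in between. Let $(\hat\rho_k,\hat u_k)\in D$, $k=1,\dots,d$. A solution of the generalized Riemann problem with artificial density $\rho_*\ge 0$ is a family of functions $(\rho_k,u_k)\colon(0,\infty)_t\times(0,\infty)_x\to D$, $k=1,\dots,d$, such that: * $(\rho_k,u_k)(0+,x)=(\hat\rho_k,\hat u_k)$ for all $x>0$ and all $k$; * for each $k$, $(\rho_k,u_k)$ coincides a.e. on $\{t>0,\ x>0\}$ with the Lax solution of the Riemann problem with left state $(\rho_*,0)$ and right state $(\hat\rho_k,\hat u_k)$; * for a.e. $t>0$ the traces $(\bar\rho_k,\bar u_k)=(\rho_k,u_k)(t,0+)$ exist, lie in $D$, and satisfy $\sum_{k=1}^d A_k\bar\rho_k\bar u_k=0$. Then, for all initial states $(\hat\rho_k,\hat u_k)\in D$, $k=1,\dots,d$ (vacuum and supersonic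 states included), the generalized Riemann problem has a solution; its artificial density $\rho_*\ge 0$ is unique, and the solution is unique up to equality a.e. in $\{t>0,\ x>0\}$. -/

import Mathlib

open MeasureTheory Filter Topology Set

noncomputable section

namespace IsentropicGas

/-- A state `(ρ, u)`: density and velocity. -/
abbrev State := ℝ × ℝ

/-- The state space `D`: positive density, or the vacuum state `(0, 0)`. -/
def D : Set State := {s | 0 < s.1 ∨ s = (0, 0)}

/-- `θ = (γ - 1) / 2`. -/
def theta (γ : ℝ) : ℝ := (γ - 1) / 2

/-- `a_γ = 2 √(γ κ) / (γ - 1)`. -/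
def aCoeff (κ γ : ℝ) : ℝ := 2 * √(γ * κ) / (γ - 1)

/-- First Riemann invariant `ω₁ = u - a_γ ρ ^ θ`. -/
def omega1 (κ γ : ℝ) (s : State) : ℝ := s.2 - aCoeff κ γ * s.1 ^ theta γ

/-- Second Riemann invariant `ω₂ = u + a_γ ρ ^ θ`. -/
def omega2 (κ γ : ℝ) (s : State) : ℝ := s.2 + aCoeff κ γ * s.1 ^ theta γ

/-- First eigenvalue `λ₁ = u - √(κ γ) ρ ^ θ`. -/
def lambda1 (κ γ : ℝ) (s : State) : ℝ := s.2 - √(κ * γ) * s.1 ^ theta γ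

/-- Second eigenvalue `λ₂ = u + √(κ γ) ρ ^ θ`. -/
def lambda2 (κ γ : ℝ) (s : State) : ℝ := s.2 + √(κ * γ) * s.1 ^ theta γ

/-- The momentum (mass flux) `ρ u`. -/
def momentum (s : State) : ℝ := s.1 * s.2

/-- The momentum flux `ρ u² + κ ρ ^ γ`. -/
def momentumFlux (κ γ : ℝ) (s : State) : ℝ := s.1 * s.2 ^ 2 + κ * s.1 ^ γ

/-- The Rankine-Hugoniot conditions for a jump from `l` to `r` travelling with speed `σ`. -/
def RankineHugoniot (κ γ σ : ℝ) (l r : State) : Prop :=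
  σ * (r.1 - l.1) = momentum r - momentum l ∧
  σ * (momentum r - momentum l) = momentumFlux κ γ r - momentumFlux κ γ l

/-- Lax-admissible 1-shock of speed `σ` with left state `l` and right state `r`. -/
def IsShock1 (κ γ σ : ℝ) (l r : State) : Prop :=
  RankineHugoniot κ γ σ l r ∧
  lambda1 κ γ r < σ ∧ σ < lambda1 κ γ l ∧ σ < lambda2 κ γ r

/-- Lax-admissible 2-shock of speed `σ` with left state `l` and right state `r`. -/
def IsShock2 (κ γ σ : ℝ) (l r : State) : Prop :=
  RankineHugoniot κ γ σ l r ∧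
  lambda2 κ γ r < σ ∧ σ < lambda2 κ γ l ∧ lambda1 κ γ l < σ

/-- On the sector `α < x / t < β` the profile `V` is a centered 1-rarefaction fan along which
the second Riemann invariant has the value `w`. -/
def IsFan1 (κ γ w α β : ℝ) (V : ℝ → State) : Prop :=
  ∀ ξ ∈ Ioo α β, V ξ ∈ D ∧ lambda1 κ γ (V ξ) = ξ ∧ omega2 κ γ (V ξ) = w

/-- On the sector `α < x / t < β` the profile `V` is a centered 2-rarefaction fan along which
the first Riemann invariant has the value `w`. -/
def IsFan2 (κ γ w α β : ℝ) (V : ℝ → State) : Prop :=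
  ∀ ξ ∈ Ioo α β, V ξ ∈ D ∧ lambda2 κ γ (V ξ) = ξ ∧ omega1 κ γ (V ξ) = w

/-- A 1-wave of `V` between the non-vacuum states `l` and `r`, occupying the speeds `[α, β]`:
a rarefaction (the trivial wave `l = r` is the case `α = β`) or an admissible shock. -/
def IsWave1 (κ γ : ℝ) (l r : State) (α β : ℝ) (V : ℝ → State) : Prop :=
  0 < l.1 ∧ 0 < r.1 ∧
  ((omega2 κ γ r = omega2 κ γ l ∧ α = lambda1 κ γ l ∧ β = lambda1 κ γ r ∧ α ≤ β ∧
      IsFan1 κ γ (omega2 κ γ l) α β V) ∨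
    (α = β ∧ IsShock1 κ γ α l r))

/-- A 2-wave of `V` between the non-vacuum states `l` and `r`, occupying the speeds `[α, β]`:
a rarefaction (the trivial wave `l = r` is the case `α = β`) or an admissible shock. -/
def IsWave2 (κ γ : ℝ) (l r : State) (α β : ℝ) (V : ℝ → State) : Prop :=
  0 < l.1 ∧ 0 < r.1 ∧
  ((omega1 κ γ r = omega1 κ γ l ∧ α = lambda2 κ γ l ∧ β = lambda2 κ γ r ∧ α ≤ β ∧
      IsFan2 κ γ (omega1 κ γ l) α β V) ∨
    (α = β ∧ IsShock2 κ γ α l r))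

/-- Lax solution without vacuum: the constant states `l`, `m`, `r`, of positive density,
are separated by a 1-wave and a 2-wave. -/
def IsLaxNonvacuum (κ γ : ℝ) (l r : State) (V : ℝ → State) : Prop :=
  ∃ (m : State) (α₁ β₁ α₂ β₂ : ℝ), β₁ ≤ α₂ ∧
    IsWave1 κ γ l m α₁ β₁ V ∧ IsWave2 κ γ m r α₂ β₂ V ∧
    (∀ ξ < α₁, V ξ = l) ∧ (∀ ξ ∈ Ioo β₁ α₂, V ξ = m) ∧ (∀ ξ > β₂, V ξ = r)

/-- To the left of the speed `v`, the left state `l` is connected to vacuum: by a complete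
1-rarefaction if `l` has positive density, by no wave at all if `l` is the vacuum. -/
def IsLeftOfVacuum (κ γ : ℝ) (l : State) (v : ℝ) (V : ℝ → State) : Prop :=
  (0 < l.1 ∧ v = omega2 κ γ l ∧ (∀ ξ < lambda1 κ γ l, V ξ = l) ∧
      IsFan1 κ γ (omega2 κ γ l) (lambda1 κ γ l) v V) ∨
    (l = (0, 0) ∧ ∀ ξ < v, V ξ = (0, 0))

/-- To the right of the speed `v`, vacuum is connected to the right state `r`: by a complete
2-rarefaction if `r` has positive density, by no wave at all if `r` is the vacuum. -/
def IsRightOfVacuum (κ γ : ℝ) (r : State) (v : ℝ) (V : ℝ → State) : Prop :=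
  (0 < r.1 ∧ v = omega1 κ γ r ∧ (∀ ξ > lambda2 κ γ r, V ξ = r) ∧
      IsFan2 κ γ (omega1 κ γ r) v (lambda2 κ γ r) V) ∨
    (r = (0, 0) ∧ ∀ ξ > v, V ξ = (0, 0))

/-- Lax solution with a (possibly degenerate) vacuum sector `v₁ < x / t < v₂`. -/
def IsLaxVacuum (κ γ : ℝ) (l r : State) (V : ℝ → State) : Prop :=
  ∃ v₁ v₂ : ℝ, v₁ ≤ v₂ ∧ IsLeftOfVacuum κ γ l v₁ V ∧ IsRightOfVacuum κ γ r v₂ V ∧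
    ∀ ξ ∈ Ioo v₁ v₂, V ξ = (0, 0)

/-- `(t, x) ↦ V (x / t)` is the self-similar weak entropy solution in the sense of Lax of the
Riemann problem with left state `l` and right state `r`. The values of `V` at the finitely many
speeds that bound the sectors are not prescribed. -/
def IsLaxSolution (κ γ : ℝ) (l r : State) (V : ℝ → State) : Prop :=
  (∀ ξ, V ξ ∈ D) ∧ (IsLaxNonvacuum κ γ l r V ∨ IsLaxVacuum κ γ l r V)

/-- `U k t x = (ρ_k, u_k)(t, x)`, for `t, x > 0`, is a solution of the generalized Riemann problem
at a junction of `d` pipes with cross sections `A k` and initial states `hat k`, with artificial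
density `ρs`. Only the values at `t, x > 0` matter. -/
structure IsGeneralizedRiemannSolution (κ γ : ℝ) {d : ℕ} (A : Fin d → ℝ) (hat : Fin d → State)
    (ρs : ℝ) (U : Fin d → ℝ → ℝ → State) : Prop where
  /-- The values are states. -/
  mem_D : ∀ k, ∀ t > 0, ∀ x > 0, U k t x ∈ D
  /-- Initial condition. -/
  initial : ∀ k, ∀ x > 0, Tendsto (fun t => U k t x) (𝓝[>] 0) (𝓝 (hat k))
  /-- The artificial density is nonnegative. -/
  density_nonneg : 0 ≤ ρs
  /-- On each pipe the solution is the restriction to `x > 0` of the Lax solution with left state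
  `(ρs, 0)` and right state `hat k`. -/
  lax : ∀ k, ∃ V : ℝ → State, IsLaxSolution κ γ (ρs, 0) (hat k) V ∧
    ∀ᵐ p : ℝ × ℝ ∂(volume.restrict (Ioi 0 ×ˢ Ioi 0)), U k p.1 p.2 = V (p.2 / p.1)
  /-- Conservation of mass for the traces at the junction. -/
  mass : ∀ᵐ t : ℝ ∂(volume.restrict (Ioi 0)), ∃ bar : Fin d → State,
    (∀ k, bar k ∈ D ∧ Tendsto (fun x => U k t x) (𝓝[>] 0) (𝓝 (bar k))) ∧
      ∑ k, A k * ((bar k).1 * (bar k).2) = 0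

end IsentropicGas

end

noncomputable section

namespace IsentropicGas

set_option linter.unusedSectionVars false

variable {κ γ : ℝ} [hκ : Fact (0 < κ)] [hγ : Fact (1 < γ)]

/-! ### Constants and powers -/

/-! Fix a pipe with right state `r` and take `(x, 0)` as left state. The Lax profile `laxProfile` is
right continuous at speed `0` (`tendsto_laxProfile`), so the trace at the junction is its value
there, and the momentum of the trace is a function `traceFlux` of `x` alone. The junction condition
becomes one scalar equation, `∑ k, A k * traceFlux κ γ (hat k) x = 0`. Each `traceFlux` is
continuous, nonpositive at `0` and nonnegative for large `x`, so the intermediate value theorem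
gives a root. It is also nondecreasing, and strictly larger at `y` than at any `x < y` once its
value at `y` is nonnegative (`traceFlux_lt`). At a root some summand is nonnegative, hence two roots
cannot differ.

Monotonicity comes from the wave curves. The 1-curve from `(x, 0)` has velocity `waveVelocity κ γ x
s` at density `s`, decreasing in `s` and increasing in `x`; the 2-curve through `r` has velocity
`backVelocity`, increasing in `s`. So the middle density `s` grows with `x`, and so does the
velocity `u` read on the fixed 2-curve. If `u ≥ 0`, the flux is the larger of `s` and the sonic
density times the smaller of `u` and the sonic velocity, and all four grow with `x`. If `u < 0`, the
flux depends on `s` only and equals `backFlux`: along a 2-rarefaction the momentum has derivative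
`λ₂` in the density, and across a 2-shock it jumps by the density jump times the shock speed.
`momentum_laxProfile` matches these formulas with the profile.

Shocks and fans are determined by densities (`isShock1_iff`, `eq_fan1_iff`), so every Lax solution
agrees with `laxProfile` off finitely many speeds (`IsLaxSolution.eq_laxProfile`), that is, almost
everywhere. -/

lemma theta_pos : 0 < theta γ := by
  have := hγ.out
  unfold theta; linarith

lemma sqrt_mul_pos : 0 < √(κ * γ) :=
  Real.sqrt_pos.2 (mul_pos hκ.out (by linarith [hγ.out]))

lemma aCoeff_mul_theta : aCoeff κ γ * theta γ = √(κ * γ) := by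
  have h : γ - 1 ≠ 0 := by linarith [hγ.out]
  unfold aCoeff theta
  rw [mul_comm γ κ]; field_simp

lemma aCoeff_pos : 0 < aCoeff κ γ := by
  have h := aCoeff_mul_theta (κ := κ) (γ := γ)
  have h' : 0 < aCoeff κ γ * theta γ := h ▸ sqrt_mul_pos
  exact pos_of_mul_pos_left h' theta_pos.le

lemma zero_rpow_theta : (0 : ℝ) ^ theta γ = 0 := Real.zero_rpow theta_pos.ne'

lemma continuous_rpow_theta : Continuous fun x : ℝ => x ^ theta γ :=
  Real.continuous_rpow_const theta_pos.le

lemma rpow_theta_lt {x y : ℝ} (hx : 0 ≤ x) (h : x < y) : x ^ theta γ < y ^ theta γ :=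
  Real.rpow_lt_rpow hx h theta_pos

lemma rpow_theta_le {x y : ℝ} (hx : 0 ≤ x) (h : x ≤ y) : x ^ theta γ ≤ y ^ theta γ :=
  Real.rpow_le_rpow hx h theta_pos.le

lemma rpow_theta_le_iff {x y : ℝ} (hx : 0 ≤ x) (hy : 0 ≤ y) :
    x ^ theta γ ≤ y ^ theta γ ↔ x ≤ y := Real.rpow_le_rpow_iff hx hy theta_pos

/-- Bernoulli's inequality for `y / x`, scaled by `x ^ p`. -/
lemma rpow_tangent_le {p x y : ℝ} (hp : 1 ≤ p) (hx : 0 < x) (hy : 0 ≤ y) :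
    x ^ p + p * x ^ (p - 1) * (y - x) ≤ y ^ p := by
  have h := one_add_mul_self_le_rpow_one_add (s := y / x - 1)
    (by have : 0 ≤ y / x := by positivity
        linarith) hp
  rw [add_sub_cancel, Real.div_rpow hy hx.le, le_div_iff₀ (by positivity)] at h
  rw [Real.rpow_sub_one hx.ne']
  calc _ = (1 + p * (y / x - 1)) * x ^ p := by field_simp
    _ ≤ _ := h

/-! ### Pressure, velocity jumps and mass fluxes of shocks -/

/-- The pressure `κ ρ ^ γ`. -/
def pressure (κ γ ρ : ℝ) : ℝ := κ * ρ ^ γ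

/-- The velocity jump across a shock between the densities `x` and `y`. -/
def velocityJump (κ γ x y : ℝ) : ℝ :=
  √((1 / x - 1 / y) * (pressure κ γ y - pressure κ γ x))

/-- The mass flux through a shock between the densities `x` and `y`. -/
def massFlux (κ γ x y : ℝ) : ℝ :=
  √(x * y * ((pressure κ γ y - pressure κ γ x) / (y - x)))

lemma pressure_lt {x y : ℝ} (hx : 0 ≤ x) (h : x < y) : pressure κ γ x < pressure κ γ y :=
  mul_lt_mul_of_pos_left (Real.rpow_lt_rpow hx h (by linarith [hγ.out])) hκ.out

lemma pressure_le {x y : ℝ} (hx : 0 ≤ x) (h : x ≤ y) : pressure κ γ x ≤ pressure κ γ y :=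
  mul_le_mul_of_nonneg_left (Real.rpow_le_rpow hx h (by linarith [hγ.out])) hκ.out.le

lemma continuous_pressure : Continuous (pressure κ γ) :=
  continuous_const.mul (Real.continuous_rpow_const (by linarith [hγ.out]))

/-- The squared sound speed is the derivative of the pressure, so convexity of the pressure turns
into comparisons of sound speeds. -/
lemma soundSpeed_sq {x : ℝ} (hx : 0 ≤ x) :
    (√(κ * γ) * x ^ theta γ) ^ 2 = κ * (γ * x ^ (γ - 1)) := by
  have h : 0 ≤ κ * γ := mul_nonneg hκ.out.le (by linarith [hγ.out])
  rw [mul_pow, Real.sq_sqrt h, ← Real.rpow_natCast, ← Real.rpow_mul hx]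
  have : theta γ * ((2 : ℕ) : ℝ) = γ - 1 := by unfold theta; push_cast; ring
  rw [this]; ring

lemma pressure_tangent_le {x y : ℝ} (hx : 0 < x) (hy : 0 ≤ y) :
    (√(κ * γ) * x ^ theta γ) ^ 2 * (y - x) ≤ pressure κ γ y - pressure κ γ x := by
  have h := mul_le_mul_of_nonneg_left (rpow_tangent_le hγ.out.le hx hy) hκ.out.le
  rw [soundSpeed_sq hx.le]; unfold pressure
  linarith

/-- The squared mass flux is `x y` times a secant slope of the pressure. By convexity this slope is
at least the squared sound speed at `x`, and `x y > x ^ 2`. With `massFlux_lt` this yields the Lax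
inequalities. -/
lemma lt_massFlux {x y : ℝ} (hx : 0 < x) (h : x < y) :
    x * (√(κ * γ) * x ^ theta γ) < massFlux κ γ x y := by
  have hxy : 0 < y - x := sub_pos.2 h
  have hk : (√(κ * γ) * x ^ theta γ) ^ 2 ≤ (pressure κ γ y - pressure κ γ x) / (y - x) := by
    rw [le_div_iff₀ hxy]; exact pressure_tangent_le hx (hx.trans h).le
  have hkpos : 0 < (pressure κ γ y - pressure κ γ x) / (y - x) :=
    div_pos (sub_pos.2 (pressure_lt hx.le h)) hxy
  refine Real.lt_sqrt_of_sq_lt ?_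
  calc (x * (√(κ * γ) * x ^ theta γ)) ^ 2 = x * x * (√(κ * γ) * x ^ theta γ) ^ 2 := by ring
    _ ≤ x * x * ((pressure κ γ y - pressure κ γ x) / (y - x)) := by gcongr
    _ < x * y * ((pressure κ γ y - pressure κ γ x) / (y - x)) := by gcongr

lemma massFlux_lt {x y : ℝ} (hx : 0 < x) (h : x < y) :
    massFlux κ γ x y < y * (√(κ * γ) * y ^ theta γ) := by
  have hy : 0 < y := hx.trans h
  have hxy : 0 < y - x := sub_pos.2 h
  have hc : 0 < √(κ * γ) := sqrt_mul_pos
  have hk : (pressure κ γ y - pressure κ γ x) / (y - x) ≤ (√(κ * γ) * y ^ theta γ) ^ 2 := by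
    rw [div_le_iff₀ hxy]
    linarith [pressure_tangent_le (κ := κ) (γ := γ) hy hx.le]
  refine (Real.sqrt_lt' (by positivity)).2 ?_
  calc x * y * ((pressure κ γ y - pressure κ γ x) / (y - x))
      ≤ x * y * (√(κ * γ) * y ^ theta γ) ^ 2 := by gcongr
    _ < y * y * (√(κ * γ) * y ^ theta γ) ^ 2 := by gcongr
    _ = _ := by ring

lemma massFlux_pos {x y : ℝ} (hx : 0 < x) (h : x < y) : 0 < massFlux κ γ x y := by
  have hc : 0 < √(κ * γ) := sqrt_mul_pos
  exact lt_trans (by positivity) (lt_massFlux hx h)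

lemma massFlux_sq {x y : ℝ} (hx : 0 < x) (h : x < y) :
    massFlux κ γ x y ^ 2 * (y - x) = x * y * (pressure κ γ y - pressure κ γ x) := by
  have hxy : 0 < y - x := sub_pos.2 h
  have hp := sub_pos.2 (pressure_lt (κ := κ) (γ := γ) hx.le h)
  have hy : 0 < y := hx.trans h
  unfold massFlux
  rw [Real.sq_sqrt (by positivity)]; field_simp

lemma massFlux_eq {x y j : ℝ} (hx : 0 < x) (h : x < y) (hj : 0 ≤ j)
    (hsq : j ^ 2 * (y - x) = x * y * (pressure κ γ y - pressure κ γ x)) :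
    j = massFlux κ γ x y := by
  have hxy : 0 < y - x := sub_pos.2 h
  have := massFlux_sq (κ := κ) (γ := γ) hx h
  rw [← hsq] at this
  exact (pow_left_inj₀ hj (massFlux_pos hx h).le two_ne_zero).1
    (mul_right_cancel₀ hxy.ne' this).symm

lemma velocityJump_eq {x y : ℝ} (hx : 0 < x) (h : x < y) :
    velocityJump κ γ x y = massFlux κ γ x y / x - massFlux κ γ x y / y := by
  have hy : 0 < y := hx.trans h
  have hxy : 0 < y - x := sub_pos.2 h
  have hj := massFlux_pos (κ := κ) (γ := γ) hx h
  have hsq := massFlux_sq (κ := κ) (γ := γ) hx h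
  have e : massFlux κ γ x y / x - massFlux κ γ x y / y
      = massFlux κ γ x y * (y - x) / (x * y) := by field_simp
  unfold velocityJump
  rw [e, Real.sqrt_eq_iff_eq_sq _ (by positivity)]
  · rw [div_pow, mul_pow]
    have : massFlux κ γ x y ^ 2 * (y - x) ^ 2
      = x * y * (pressure κ γ y - pressure κ γ x) * (y - x) := by rw [← hsq]; ring
    rw [this]; field_simp
  · refine mul_nonneg (sub_nonneg.2 (one_div_le_one_div_of_le hx h.le)) ?_
    exact sub_nonneg.2 (pressure_le hx.le h.le)

/-- Secant slopes of the convex pressure from the fixed point `x` increase. This makes the shock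
speed monotone in the density behind the shock. -/
lemma massFlux_le {x y z : ℝ} (hx : 0 < x) (hxy : x < y) (hyz : y ≤ z) :
    massFlux κ γ x y ≤ massFlux κ γ x z := by
  have hy : 0 < y := hx.trans hxy
  have hc := (convexOn_rpow hγ.out.le).secant_mono (a := x) (x := y) (y := z)
    hx.le hy.le (hy.trans_le hyz).le hxy.ne' (hxy.trans_le hyz).ne' hyz
  have key : (pressure κ γ y - pressure κ γ x) / (y - x)
      ≤ (pressure κ γ z - pressure κ γ x) / (z - x) := by
    have := mul_le_mul_of_nonneg_left hc hκ.out.le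
    unfold pressure
    calc _ = κ * ((y ^ γ - x ^ γ) / (y - x)) := by ring
      _ ≤ _ := this
      _ = _ := by ring
  have h0 : 0 ≤ (pressure κ γ y - pressure κ γ x) / (y - x) :=
    div_nonneg (sub_nonneg.2 (pressure_le hx.le hxy.le)) (sub_nonneg.2 hxy.le)
  have hz : 0 < z := hy.trans_le hyz
  unfold massFlux
  gcongr

/-! ### Velocity jumps as functions of the densities -/

lemma velocityJump_pos {x y : ℝ} (hx : 0 < x) (h : x < y) : 0 < velocityJump κ γ x y :=
  Real.sqrt_pos.2 (mul_pos (sub_pos.2 (one_div_lt_one_div_of_lt hx h))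
    (sub_pos.2 (pressure_lt hx.le h)))

lemma velocityJump_self (x : ℝ) : velocityJump κ γ x x = 0 := by simp [velocityJump]

lemma velocityJump_lt_right {x y z : ℝ} (hx : 0 < x) (hxy : x ≤ y) (hyz : y < z) :
    velocityJump κ γ x y < velocityJump κ γ x z := by
  have hy := hx.trans_le hxy
  have h1 : 1 / z < 1 / y := one_div_lt_one_div_of_lt hy hyz
  have h2 : 1 / y ≤ 1 / x := one_div_le_one_div_of_le hx hxy
  have h3 := pressure_lt (κ := κ) (γ := γ) hy.le hyz
  have h4 := pressure_le (κ := κ) (γ := γ) hx.le hxy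
  refine Real.sqrt_lt_sqrt (mul_nonneg (by linarith) (by linarith)) ?_
  exact mul_lt_mul'' (by linarith) (by linarith) (by linarith) (by linarith)

lemma velocityJump_lt_left {x y z : ℝ} (hx : 0 < x) (hxy : x < y) (hyz : y ≤ z) :
    velocityJump κ γ y z < velocityJump κ γ x z := by
  have hy := hx.trans hxy
  have h1 : 1 / y < 1 / x := one_div_lt_one_div_of_lt hx hxy
  have h2 : 1 / z ≤ 1 / y := one_div_le_one_div_of_le hy hyz
  have h3 := pressure_lt (κ := κ) (γ := γ) hx.le hxy
  have h4 := pressure_le (κ := κ) (γ := γ) hy.le hyz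
  refine Real.sqrt_lt_sqrt (mul_nonneg (by linarith) (by linarith)) ?_
  exact mul_lt_mul'' (by linarith) (by linarith) (by linarith) (by linarith)

/-! ### Wave curves -/

/-- The velocity gained through a 1-wave from density `x` to density `s`. -/
def waveVelocity (κ γ x s : ℝ) : ℝ :=
  if s ≤ x then aCoeff κ γ * (x ^ theta γ - s ^ theta γ) else -velocityJump κ γ x s

lemma waveVelocity_of_le {x s : ℝ} (h : s ≤ x) :
    waveVelocity κ γ x s = aCoeff κ γ * (x ^ theta γ - s ^ theta γ) := if_pos h

lemma waveVelocity_of_lt {x s : ℝ} (h : x < s) :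
    waveVelocity κ γ x s = -velocityJump κ γ x s := if_neg h.not_ge

lemma waveVelocity_self (x : ℝ) : waveVelocity κ γ x x = 0 := by simp [waveVelocity]

lemma waveVelocity_zero {x : ℝ} (h : 0 ≤ x) :
    waveVelocity κ γ x 0 = aCoeff κ γ * x ^ theta γ := by
  rw [waveVelocity_of_le h, zero_rpow_theta, sub_zero]

lemma waveVelocity_lt_right {x s t : ℝ} (hx : 0 < x) (hs : 0 ≤ s) (h : s < t) :
    waveVelocity κ γ x t < waveVelocity κ γ x s := by
  have ha : 0 < aCoeff κ γ := aCoeff_pos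
  rcases le_or_gt t x with htx | hxt
  · rw [waveVelocity_of_le htx, waveVelocity_of_le (h.le.trans htx)]
    have := rpow_theta_lt (γ := γ) hs h
    gcongr
  rcases le_or_gt s x with hsx | hxs
  · rw [waveVelocity_of_le hsx, waveVelocity_of_lt hxt]
    have h1 := velocityJump_pos (κ := κ) (γ := γ) hx hxt
    have h2 := mul_nonneg ha.le (sub_nonneg.2 (rpow_theta_le (γ := γ) hs hsx))
    linarith
  · rw [waveVelocity_of_lt hxs, waveVelocity_of_lt hxt]
    exact neg_lt_neg (velocityJump_lt_right hx hxs.le h)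

/-- Raising the left density lifts the whole 1-wave curve; this is what makes the middle density
grow with the artificial density. -/
lemma waveVelocity_lt_left {x y s : ℝ} (hx : 0 < x) (hs : 0 ≤ s) (h : x < y) :
    waveVelocity κ γ x s < waveVelocity κ γ y s := by
  have ha : 0 < aCoeff κ γ := aCoeff_pos
  rcases le_or_gt s x with hsx | hxs
  · rw [waveVelocity_of_le hsx, waveVelocity_of_le (hsx.trans h.le)]
    have := rpow_theta_lt (γ := γ) hx.le h
    gcongr
  rcases le_or_gt s y with hsy | hys
  · rw [waveVelocity_of_lt hxs, waveVelocity_of_le hsy]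
    have h1 := velocityJump_pos (κ := κ) (γ := γ) hx hxs
    have h2 := mul_nonneg ha.le (sub_nonneg.2 (rpow_theta_le (γ := γ) hs hsy))
    linarith
  · rw [waveVelocity_of_lt hxs, waveVelocity_of_lt hys]
    exact neg_lt_neg (velocityJump_lt_left hx h hys.le)

lemma waveVelocity_pos_iff {x s : ℝ} (hx : 0 < x) (hs : 0 ≤ s) :
    0 < waveVelocity κ γ x s ↔ s < x := by
  constructor
  · intro h
    by_contra! hxs
    rcases hxs.eq_or_lt with rfl | hxs
    · simp [waveVelocity_self] at h
    · have := waveVelocity_lt_right (κ := κ) (γ := γ) hx hx.le hxs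
      rw [waveVelocity_self] at this; linarith
  · intro h
    have := waveVelocity_lt_right (κ := κ) (γ := γ) hx hs h
    rwa [waveVelocity_self] at this

lemma waveVelocity_neg_iff {x s : ℝ} (hx : 0 < x) (hs : 0 ≤ s) :
    waveVelocity κ γ x s < 0 ↔ x < s := by
  constructor
  · intro h
    by_contra! hxs
    rcases hxs.eq_or_lt with rfl | hxs
    · simp [waveVelocity_self] at h
    · linarith [(waveVelocity_pos_iff (κ := κ) (γ := γ) hx hs).2 hxs]
  · intro h
    have := waveVelocity_lt_right (κ := κ) (γ := γ) hx hx.le h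
    rwa [waveVelocity_self] at this

lemma continuousOn_velocityJump_right {x : ℝ} (hx : 0 < x) :
    ContinuousOn (velocityJump κ γ x) (Ici x) := by
  unfold velocityJump
  refine Real.continuous_sqrt.comp_continuousOn (ContinuousOn.mul ?_ ?_)
  · exact continuousOn_const.sub (continuousOn_const.div continuousOn_id
      fun y hy => (hx.trans_le hy).ne')
  · exact (continuous_pressure.sub continuous_const).continuousOn

lemma continuousOn_velocityJump_left {y : ℝ} :
    ContinuousOn (fun x => velocityJump κ γ x y) (Ioi 0) := by
  unfold velocityJump
  refine Real.continuous_sqrt.comp_continuousOn (ContinuousOn.mul ?_ ?_)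
  · exact (continuousOn_const.div continuousOn_id
      fun y (hy : 0 < y) => hy.ne').sub continuousOn_const
  · exact (continuous_const.sub continuous_pressure).continuousOn

lemma continuous_waveVelocity_right {x : ℝ} (hx : 0 < x) :
    Continuous (waveVelocity κ γ x) := by
  unfold waveVelocity
  refine continuous_if_le continuous_id continuous_const ?_ ?_ ?_
  · exact (continuous_const.mul (continuous_const.sub continuous_rpow_theta)).continuousOn
  · exact (continuousOn_velocityJump_right hx).neg
  · rintro s rfl
    simp [velocityJump_self]

/-- One of the two terms always vanishes. The form removes the case distinction, so continuity in
`x` can be read off. -/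
lemma waveVelocity_eq_max_min (x s : ℝ) :
    waveVelocity κ γ x s =
      aCoeff κ γ * ((max x s) ^ theta γ - s ^ theta γ) - velocityJump κ γ (min x s) s := by
  rcases le_or_gt s x with h | h
  · simp [waveVelocity_of_le h, h, velocityJump_self]
  · simp [waveVelocity_of_lt h, h.le]

lemma continuousOn_waveVelocity_left {s : ℝ} (hs : 0 ≤ s) :
    ContinuousOn (fun x => waveVelocity κ γ x s) (Ioi 0) := by
  rcases hs.eq_or_lt with rfl | hs
  · refine ContinuousOn.congr (f := fun x => aCoeff κ γ * x ^ theta γ)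
      (continuous_const.mul continuous_rpow_theta).continuousOn ?_
    intro x (hx : 0 < x)
    exact waveVelocity_zero hx.le
  · simp only [waveVelocity_eq_max_min]
    refine ContinuousOn.sub ?_ ?_
    · exact (continuous_const.mul ((continuous_rpow_theta.comp
        (continuous_id.max continuous_const)).sub continuous_const)).continuousOn
    · exact continuousOn_velocityJump_left.comp
        (continuous_id.min continuous_const).continuousOn fun x (hx : 0 < x) => lt_min hx hs

lemma tendsto_waveVelocity_atTop {x : ℝ} (hx : 0 < x) :
    Tendsto (waveVelocity κ γ x) atTop atBot := by
  have h : Tendsto (velocityJump κ γ x) atTop atTop := by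
    refine Real.tendsto_sqrt_atTop.comp (Tendsto.pos_mul_atTop (C := 1 / x - 0) ?_ ?_ ?_)
    · simpa using hx
    · simpa [one_div] using (tendsto_const_nhds (x := 1 / x)).sub tendsto_inv_atTop_zero
    · refine tendsto_atTop_add_const_right _ _ ?_
      exact (tendsto_rpow_atTop (by linarith [hγ.out])).const_mul_atTop hκ.out
  refine (tendsto_neg_atTop_atBot.comp h).congr' ?_
  filter_upwards [eventually_gt_atTop x] with s hs
  simp [waveVelocity_of_lt hs]

/-- The factor `1 / x` in the velocity jump blows up. This forces the middle density to `0` as the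
left density tends to `0`. -/
lemma tendsto_waveVelocity_zero {s : ℝ} (hs : 0 < s) :
    Tendsto (fun x => waveVelocity κ γ x s) (𝓝[>] 0) atBot := by
  have h : Tendsto (fun x => velocityJump κ γ x s) (𝓝[>] 0) atTop := by
    refine Real.tendsto_sqrt_atTop.comp
      (Tendsto.atTop_mul_pos (C := pressure κ γ s - pressure κ γ 0) ?_ ?_ ?_)
    · exact sub_pos.2 (pressure_lt le_rfl hs)
    · refine tendsto_atTop_add_const_right _ _ ?_
      exact (tendsto_inv_nhdsGT_zero (𝕜 := ℝ)).congr fun x => (one_div x).symm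
    · exact tendsto_const_nhds.sub (continuous_pressure.tendsto 0 |>.mono_left nhdsWithin_le_nhds)
  refine (tendsto_neg_atTop_atBot.comp h).congr' ?_
  filter_upwards [Ioo_mem_nhdsGT hs] with x hx
  simp [waveVelocity_of_lt hx.2]

/-! ### Reflection -/

/-- The state seen after the reflection `x ↦ -x`. -/
def reflect (s : State) : State := (s.1, -s.2)

@[simp] lemma reflect_fst (s : State) : (reflect s).1 = s.1 := rfl
@[simp] lemma reflect_snd (s : State) : (reflect s).2 = -s.2 := rfl
@[simp] lemma reflect_reflect (s : State) : reflect (reflect s) = s := by simp [reflect]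
@[simp] lemma lambda1_reflect (s : State) : lambda1 κ γ (reflect s) = -lambda2 κ γ s := by
  simp only [lambda1, lambda2, reflect]; ring
@[simp] lemma lambda2_reflect (s : State) : lambda2 κ γ (reflect s) = -lambda1 κ γ s := by
  simp only [lambda1, lambda2, reflect]; ring
@[simp] lemma omega2_reflect (s : State) : omega2 κ γ (reflect s) = -omega1 κ γ s := by
  simp only [omega1, omega2, reflect]; ring
@[simp] lemma reflect_mem_D {s : State} : reflect s ∈ D ↔ s ∈ D := by
  simp [D, Prod.ext_iff]

/-- Reflection swaps the two sides and the two characteristic families, so all facts about 2-waves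
follow from those about 1-waves. -/
lemma isShock1_reflect {σ : ℝ} {l r : State} :
    IsShock1 κ γ (-σ) (reflect r) (reflect l) ↔ IsShock2 κ γ σ l r := by
  simp only [IsShock1, IsShock2, RankineHugoniot, momentum, momentumFlux, lambda1_reflect,
    lambda2_reflect, reflect_fst, reflect_snd, neg_lt_neg_iff]
  constructor
  · rintro ⟨⟨h1, h2⟩, h3, h4, h5⟩
    exact ⟨⟨by linarith, by linarith⟩, h4, h3, h5⟩
  · rintro ⟨⟨h1, h2⟩, h3, h4, h5⟩
    exact ⟨⟨by linarith, by linarith⟩, h4, h3, h5⟩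

lemma isFan1_reflect {w α β : ℝ} {V : ℝ → State} :
    IsFan1 κ γ (-w) (-β) (-α) (fun ξ => reflect (V (-ξ))) ↔ IsFan2 κ γ w α β V := by
  simp only [IsFan1, IsFan2, lambda1_reflect, omega2_reflect, reflect_mem_D, neg_inj]
  constructor
  · intro h ξ hξ
    have := h (-ξ) ⟨neg_lt_neg hξ.2, neg_lt_neg hξ.1⟩
    simpa using this
  · intro h ξ hξ
    have := h (-ξ) ⟨by linarith [hξ.2], by linarith [hξ.1]⟩
    exact ⟨this.1, by linarith [this.2.1], this.2.2⟩

lemma isWave1_reflect {l r : State} {α β : ℝ} {V : ℝ → State} :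
    IsWave1 κ γ (reflect r) (reflect l) (-β) (-α) (fun ξ => reflect (V (-ξ))) ↔
      IsWave2 κ γ l r α β V := by
  simp only [IsWave1, IsWave2, omega2_reflect, isFan1_reflect, lambda1_reflect, reflect_fst,
    neg_inj, neg_le_neg_iff]
  constructor
  · rintro ⟨h1, h2, ⟨h3, h4, h5, h6, h7⟩ | ⟨h3, h4⟩⟩
    · exact ⟨h2, h1, Or.inl ⟨h3.symm, h5, h4, h6, h3 ▸ h7⟩⟩
    · subst h3
      exact ⟨h2, h1, Or.inr ⟨rfl, isShock1_reflect.1 h4⟩⟩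
  · rintro ⟨h1, h2, ⟨h3, h4, h5, h6, h7⟩ | ⟨h3, h4⟩⟩
    · exact ⟨h2, h1, Or.inl ⟨h3.symm, h5, h4, h6, h3 ▸ h7⟩⟩
    · subst h3
      exact ⟨h2, h1, Or.inr ⟨rfl, isShock1_reflect.2 h4⟩⟩

/-! ### Centered fans -/

/-- The density at which `(a_γ + √(κ γ)) ρ ^ θ = y`; zero if `y ≤ 0`. -/
def fanDensity (κ γ y : ℝ) : ℝ := (max y 0 / (aCoeff κ γ + √(κ * γ))) ^ (theta γ)⁻¹

/-- The state of a 1-rarefaction fan with second Riemann invariant `w` at the speed `ξ`,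
continued by vacuum for `ξ ≥ w`. -/
def fan1 (κ γ w ξ : ℝ) : State :=
  (fanDensity κ γ (w - ξ), if ξ < w then ξ + √(κ * γ) * fanDensity κ γ (w - ξ) ^ theta γ else 0)

/-- The state of a 2-rarefaction fan with first Riemann invariant `w` at the speed `ξ`,
continued by vacuum for `ξ ≤ w`. -/
def fan2 (κ γ w ξ : ℝ) : State := reflect (fan1 κ γ (-w) (-ξ))

lemma aCoeff_add_pos : 0 < aCoeff κ γ + √(κ * γ) := add_pos aCoeff_pos sqrt_mul_pos

lemma fanDensity_nonneg (y : ℝ) : 0 ≤ fanDensity κ γ y := by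
  have := aCoeff_add_pos (κ := κ) (γ := γ)
  unfold fanDensity; positivity

lemma fanDensity_rpow (y : ℝ) :
    fanDensity κ γ y ^ theta γ = max y 0 / (aCoeff κ γ + √(κ * γ)) := by
  have := aCoeff_add_pos (κ := κ) (γ := γ)
  exact Real.rpow_inv_rpow (by positivity) theta_pos.ne'

lemma fanDensity_of_nonpos {y : ℝ} (h : y ≤ 0) : fanDensity κ γ y = 0 := by
  rw [fanDensity, max_eq_right h, zero_div, Real.zero_rpow (inv_ne_zero theta_pos.ne')]

lemma fanDensity_pos {y : ℝ} (h : 0 < y) : 0 < fanDensity κ γ y := by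
  have := aCoeff_add_pos (κ := κ) (γ := γ)
  have : 0 < max y 0 := lt_max_of_lt_left h
  unfold fanDensity; positivity

lemma continuous_fanDensity : Continuous (fanDensity κ γ) := by
  unfold fanDensity
  exact (Real.continuous_rpow_const (inv_nonneg.2 theta_pos.le)).comp
    ((continuous_id.max continuous_const).div_const _)

lemma fanDensity_le_iff {y s : ℝ} (hs : 0 ≤ s) :
    fanDensity κ γ y ≤ s ↔ y ≤ (aCoeff κ γ + √(κ * γ)) * s ^ theta γ := by
  have ha := aCoeff_add_pos (κ := κ) (γ := γ)
  rw [← rpow_theta_le_iff (γ := γ) (fanDensity_nonneg y) hs, fanDensity_rpow, div_le_iff₀ ha,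
    max_le_iff, mul_comm]
  exact and_iff_left (by positivity)

lemma fanDensity_mul_rpow {s : ℝ} (hs : 0 ≤ s) :
    fanDensity κ γ ((aCoeff κ γ + √(κ * γ)) * s ^ theta γ) = s := by
  have ha := aCoeff_add_pos (κ := κ) (γ := γ)
  rw [fanDensity, max_eq_left (by positivity), mul_div_cancel_left₀ _ ha.ne',
    Real.rpow_rpow_inv hs theta_pos.ne']

lemma fan1_mem_D (w ξ : ℝ) : fan1 κ γ w ξ ∈ D := by
  rcases lt_or_ge ξ w with h | h
  · exact Or.inl (fanDensity_pos (sub_pos.2 h))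
  · right
    simp [fan1, h.not_gt, fanDensity_of_nonpos (sub_nonpos.2 h)]

lemma fan2_mem_D (w ξ : ℝ) : fan2 κ γ w ξ ∈ D := reflect_mem_D.2 (fan1_mem_D _ _)

lemma fan1_of_le {w ξ : ℝ} (h : w ≤ ξ) : fan1 κ γ w ξ = (0, 0) := by
  simp [fan1, h.not_gt, fanDensity_of_nonpos (sub_nonpos.2 h)]

lemma fan2_of_le {w ξ : ℝ} (h : ξ ≤ w) : fan2 κ γ w ξ = (0, 0) := by
  simp [fan2, fan1_of_le (neg_le_neg h), reflect]

lemma nonneg_of_mem_D {s : State} (hs : s ∈ D) : 0 ≤ s.1 := by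
  rcases hs with h | rfl
  · exact h.le
  · exact le_rfl

/-- The difference `ω₂ - λ₁` is `(a_γ + √(κ γ)) ρ ^ θ`, which is injective in `ρ`; the density, and
then the velocity, are determined. -/
lemma eq_fan1_iff {w ξ : ℝ} {s : State} (h : ξ < w) :
    (s ∈ D ∧ lambda1 κ γ s = ξ ∧ omega2 κ γ s = w) ↔ s = fan1 κ γ w ξ := by
  have ha := aCoeff_add_pos (κ := κ) (γ := γ)
  constructor
  · rintro ⟨hD, h1, h2⟩
    have h0 := nonneg_of_mem_D hD
    have e : w - ξ = (aCoeff κ γ + √(κ * γ)) * s.1 ^ theta γ := by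
      rw [← h1, ← h2, lambda1, omega2]; ring
    have e1 : fanDensity κ γ (w - ξ) = s.1 := by rw [e, fanDensity_mul_rpow h0]
    refine Prod.ext e1.symm ?_
    simp only [fan1, if_pos h, e1]
    rw [← h1, lambda1]; ring
  · rintro rfl
    refine ⟨fan1_mem_D _ _, ?_, ?_⟩
    · simp only [lambda1, fan1, if_pos h]; ring
    · simp only [omega2, fan1, if_pos h, fanDensity_rpow, max_eq_left (sub_pos.2 h).le]
      field_simp
      ring

lemma isFan1_iff {w α β : ℝ} {V : ℝ → State} (h : β ≤ w) :
    IsFan1 κ γ w α β V ↔ ∀ ξ ∈ Ioo α β, V ξ = fan1 κ γ w ξ :=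
  forall₂_congr fun _ hξ => eq_fan1_iff (hξ.2.trans_le h)

lemma isFan2_iff {w α β : ℝ} {V : ℝ → State} (h : w ≤ α) :
    IsFan2 κ γ w α β V ↔ ∀ ξ ∈ Ioo α β, V ξ = fan2 κ γ w ξ := by
  rw [← isFan1_reflect, isFan1_iff (neg_le_neg h)]
  constructor
  · intro H ξ hξ
    have := H (-ξ) ⟨neg_lt_neg hξ.2, neg_lt_neg hξ.1⟩
    rw [neg_neg] at this
    rw [fan2, ← this, reflect_reflect]
  · intro H ξ hξ
    rw [H (-ξ) ⟨by linarith [hξ.2], by linarith [hξ.1]⟩, fan2, reflect_reflect, neg_neg]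

/-! ### Shocks and waves in terms of the densities -/

/-- The first jump condition says that the relative mass flux `j = x (u - σ) = y (v - σ)` is common
to both sides; the second becomes `j (u - v) = p(y) - p(x)`. The Lax inequalities place `j` strictly
between the values of density times sound speed at `l` and at `r`; this product increases with
density, so the density rises across the shock, and `j` is the positive root `massFlux`. -/
lemma isShock1_iff {σ : ℝ} {l r : State} (hl : 0 < l.1) (hr : 0 < r.1) :
    IsShock1 κ γ σ l r ↔ l.1 < r.1 ∧ σ = l.2 - massFlux κ γ l.1 r.1 / l.1 ∧
      r.2 = l.2 - velocityJump κ γ l.1 r.1 := by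
  obtain ⟨x, u⟩ := l
  obtain ⟨y, v⟩ := r
  simp only [IsShock1, RankineHugoniot, momentum, momentumFlux, lambda1, lambda2] at *
  have hp : ∀ ρ, κ * ρ ^ γ = pressure κ γ ρ := fun _ => rfl
  have hc : 0 < √(κ * γ) := sqrt_mul_pos
  rw [hp, hp]
  constructor
  · rintro ⟨⟨h1, h2⟩, h3, h4, -⟩
    have hj : y * (v - σ) = x * (u - σ) := by linarith
    have hm : x * (u - σ) * (u - v) = pressure κ γ y - pressure κ γ x := by
      linear_combination h2 + v * hj
    have hx : x * (√(κ * γ) * x ^ theta γ) < x * (u - σ) := by gcongr; linarith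
    have hy : y * (v - σ) < y * (√(κ * γ) * y ^ theta γ) := by gcongr; linarith
    have hxy : x < y := by
      by_contra! hle
      have : y * (√(κ * γ) * y ^ theta γ) ≤ x * (√(κ * γ) * x ^ theta γ) := by
        have := rpow_theta_le (γ := γ) hr.le hle
        gcongr
      linarith
    have hjpos : 0 ≤ x * (u - σ) := le_trans (by positivity) hx.le
    have hJ : x * (u - σ) = massFlux κ γ x y := by
      refine massFlux_eq hl hxy hjpos ?_
      rw [← hm]
      linear_combination x * (u - σ) * x * hj
    refine ⟨hxy, ?_, ?_⟩
    · rw [← hJ]; field_simp; ring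
    · rw [velocityJump_eq hl hxy, ← hJ]
      nth_rewrite 2 [← hj]
      field_simp; ring
  · rintro ⟨hxy, rfl, rfl⟩
    have hsq := massFlux_sq (κ := κ) (γ := γ) hl hxy
    have h1 := lt_massFlux (κ := κ) (γ := γ) hl hxy
    have h2 := massFlux_lt (κ := κ) (γ := γ) hl hxy
    have h3 := massFlux_pos (κ := κ) (γ := γ) hl hxy
    rw [velocityJump_eq hl hxy]
    set J := massFlux κ γ x y
    have e1 : √(κ * γ) * x ^ theta γ < J / x := by rw [lt_div_iff₀ hl]; linarith
    have e2 : J / y < √(κ * γ) * y ^ theta γ := by rw [div_lt_iff₀ hr]; linarith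
    have e3 : 0 < J / y := by positivity
    have e4 : pressure κ γ y - pressure κ γ x = J ^ 2 * (y - x) / (x * y) := by
      rw [hsq]; field_simp
    have e5 : y * (J / y) = J := by field_simp
    have e6 : x * (J / x) = J := by field_simp
    refine ⟨⟨?_, ?_⟩, by linarith, by linarith, ?_⟩
    · linear_combination e6 - e5
    · have e4' : pressure κ γ y = pressure κ γ x + J ^ 2 * (y - x) / (x * y) := by linarith
      rw [e4']; field_simp; ring
    · have : 0 < √(κ * γ) * y ^ theta γ := by positivity
      linarith

/-- The smallest speed of the 1-wave from the left state `l` to density `s`. -/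
def headSpeed (κ γ : ℝ) (l : State) (s : ℝ) : ℝ :=
  if s ≤ l.1 then lambda1 κ γ l else l.2 - massFlux κ γ l.1 s / l.1

/-- The largest speed of the 1-wave from the left state `l` to density `s`. -/
def tailSpeed (κ γ : ℝ) (l : State) (s : ℝ) : ℝ :=
  if s ≤ l.1 then l.2 + waveVelocity κ γ l.1 s - √(κ * γ) * s ^ theta γ
  else l.2 - massFlux κ γ l.1 s / l.1

lemma headSpeed_le_tailSpeed {l : State} {s : ℝ} (hs : 0 ≤ s) :
    headSpeed κ γ l s ≤ tailSpeed κ γ l s := by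
  unfold headSpeed tailSpeed
  split_ifs with h
  · have ha := aCoeff_add_pos (κ := κ) (γ := γ)
    have := mul_le_mul_of_nonneg_left (rpow_theta_le (γ := γ) hs h) ha.le
    rw [waveVelocity_of_le h, lambda1]; linarith
  · exact le_rfl

lemma tailSpeed_le_omega2 {l : State} {s : ℝ} (hl : 0 ≤ l.1) (hs : 0 ≤ s) :
    tailSpeed κ γ l s ≤ omega2 κ γ l := by
  have ha := aCoeff_add_pos (κ := κ) (γ := γ)
  have ha' := aCoeff_pos (κ := κ) (γ := γ)
  unfold tailSpeed omega2
  split_ifs with h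
  · rw [waveVelocity_of_le h]
    have : 0 ≤ (aCoeff κ γ + √(κ * γ)) * s ^ theta γ := by positivity
    linarith
  · have h1 : 0 ≤ massFlux κ γ l.1 s / l.1 := div_nonneg (Real.sqrt_nonneg _) hl
    have : 0 ≤ aCoeff κ γ * l.1 ^ theta γ := by positivity
    linarith

/-- The 1-wave is slower than the gas behind it. Applied also to the reflected right state, this
places the middle velocity strictly between the two waves. -/
lemma tailSpeed_lt {l : State} {s : ℝ} (hl : 0 < l.1) (hs : 0 < s) :
    tailSpeed κ γ l s < l.2 + waveVelocity κ γ l.1 s := by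
  have hc : 0 < √(κ * γ) := sqrt_mul_pos
  unfold tailSpeed
  split_ifs with h
  · have : 0 < √(κ * γ) * s ^ theta γ := by positivity
    linarith
  · push Not at h
    rw [waveVelocity_of_lt h, velocityJump_eq hl h]
    have := div_pos (massFlux_pos (κ := κ) (γ := γ) hl h) hs
    linarith

lemma headSpeed_zero {l : State} (hl : 0 ≤ l.1) : headSpeed κ γ l 0 = lambda1 κ γ l := if_pos hl

lemma tailSpeed_zero {l : State} (hl : 0 ≤ l.1) : tailSpeed κ γ l 0 = omega2 κ γ l := by
  rw [tailSpeed, if_pos hl, waveVelocity_zero hl, zero_rpow_theta, omega2]; ring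

lemma isWave1_iff {l m : State} {α β : ℝ} {V : ℝ → State} :
    IsWave1 κ γ l m α β V ↔ 0 < l.1 ∧ 0 < m.1 ∧ m.2 = l.2 + waveVelocity κ γ l.1 m.1 ∧
      α = headSpeed κ γ l m.1 ∧ β = tailSpeed κ γ l m.1 ∧
      ∀ ξ ∈ Ioo α β, V ξ = fan1 κ γ (omega2 κ γ l) ξ := by
  have ha := aCoeff_add_pos (κ := κ) (γ := γ)
  unfold IsWave1
  refine and_congr_right fun hl => and_congr_right fun hm => ?_
  constructor
  · rintro (⟨h1, rfl, rfl, h2, h3⟩ | ⟨rfl, h⟩)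
    · have hle : m.1 ≤ l.1 := by
        rw [← rpow_theta_le_iff (γ := γ) hm.le hl.le]
        refine le_of_mul_le_mul_left ?_ ha
        simp only [omega2, lambda1] at h1 h2
        linarith
      have hv : m.2 = l.2 + waveVelocity κ γ l.1 m.1 := by
        rw [waveVelocity_of_le hle]
        simp only [omega2] at h1
        linarith
      have hβ : lambda1 κ γ m = tailSpeed κ γ l m.1 := by
        rw [tailSpeed, if_pos hle, ← hv, lambda1]
      refine ⟨hv, ?_, hβ, ?_⟩
      · rw [headSpeed, if_pos hle]
      · exact (isFan1_iff (hβ ▸ tailSpeed_le_omega2 hl.le hm.le)).1 h3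
    · obtain ⟨h1, rfl, h3⟩ := (isShock1_iff hl hm).1 h
      refine ⟨?_, ?_, ?_, by simp⟩
      · rw [waveVelocity_of_lt h1, h3]; ring
      · rw [headSpeed, if_neg h1.not_ge]
      · rw [tailSpeed, if_neg h1.not_ge]
  · rintro ⟨hv, rfl, rfl, hV⟩
    rcases le_or_gt m.1 l.1 with hle | hlt
    · left
      refine ⟨?_, if_pos hle, ?_, headSpeed_le_tailSpeed hm.le,
        (isFan1_iff (tailSpeed_le_omega2 hl.le hm.le)).2 hV⟩
      · rw [omega2, hv, waveVelocity_of_le hle, omega2]; ring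
      · rw [tailSpeed, if_pos hle, ← hv, lambda1]
    · right
      refine ⟨?_, (isShock1_iff hl hm).2 ⟨hlt, if_neg hlt.not_ge, ?_⟩⟩
      · rw [headSpeed, tailSpeed, if_neg hlt.not_ge, if_neg hlt.not_ge]
      · rw [hv, waveVelocity_of_lt hlt]; ring

lemma isWave2_iff {m r : State} {α β : ℝ} {V : ℝ → State} :
    IsWave2 κ γ m r α β V ↔ 0 < r.1 ∧ 0 < m.1 ∧ m.2 = r.2 - waveVelocity κ γ r.1 m.1 ∧
      α = -tailSpeed κ γ (reflect r) m.1 ∧ β = -headSpeed κ γ (reflect r) m.1 ∧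
      ∀ ξ ∈ Ioo α β, V ξ = fan2 κ γ (omega1 κ γ r) ξ := by
  rw [← isWave1_reflect, isWave1_iff]
  simp only [reflect_fst, reflect_snd, omega2_reflect, neg_eq_iff_eq_neg]
  refine and_congr_right fun _ => and_congr_right fun _ => ?_
  have hfan : (∀ ξ ∈ Ioo (-β) (-α), reflect (V (-ξ)) = fan1 κ γ (-omega1 κ γ r) ξ) ↔
      ∀ ξ ∈ Ioo α β, V ξ = fan2 κ γ (omega1 κ γ r) ξ := by
    constructor
    · intro H ξ hξ
      have := H (-ξ) ⟨neg_lt_neg hξ.2, neg_lt_neg hξ.1⟩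
      rw [neg_neg] at this
      rw [fan2, ← this, reflect_reflect]
    · intro H ξ hξ
      rw [H (-ξ) ⟨by linarith [hξ.2], by linarith [hξ.1]⟩, fan2, reflect_reflect, neg_neg]
  have hv : m.2 = -(-r.2 + waveVelocity κ γ r.1 m.1) ↔
      m.2 = r.2 - waveVelocity κ γ r.1 m.1 := by
    rw [show -(-r.2 + waveVelocity κ γ r.1 m.1) = r.2 - waveVelocity κ γ r.1 m.1 by ring]
  rw [hfan, hv]
  tauto

/-! ### The middle state -/

open Classical in
/-- The density of the middle state of the Riemann problem with left state `(x, 0)` and right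
state `r`; zero if there is a vacuum. -/
def middleDensity (κ γ x : ℝ) (r : State) : ℝ :=
  if h : ∃ s, 0 < s ∧ 0 < x ∧ 0 < r.1 ∧ waveVelocity κ γ x s + waveVelocity κ γ r.1 s = r.2
  then h.choose else 0

lemma middleDensity_nonneg (x : ℝ) (r : State) : 0 ≤ middleDensity κ γ x r := by
  unfold middleDensity
  split_ifs with h
  · exact h.choose_spec.1.le
  · exact le_rfl

lemma middleDensity_spec {x : ℝ} {r : State} (h : 0 < middleDensity κ γ x r) :
    0 < x ∧ 0 < r.1 ∧ waveVelocity κ γ x (middleDensity κ γ x r) +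
      waveVelocity κ γ r.1 (middleDensity κ γ x r) = r.2 := by
  have hex : ∃ s, 0 < s ∧ 0 < x ∧ 0 < r.1 ∧
      waveVelocity κ γ x s + waveVelocity κ γ r.1 s = r.2 := by
    by_contra hn
    rw [middleDensity, dif_neg hn] at h
    exact lt_irrefl _ h
  rw [middleDensity, dif_pos hex]
  exact hex.choose_spec.2

lemma waveVelocity_add_lt {x y s t : ℝ} (hx : 0 < x) (hy : 0 < y) (hs : 0 ≤ s) (h : s < t) :
    waveVelocity κ γ x t + waveVelocity κ γ y t < waveVelocity κ γ x s + waveVelocity κ γ y s :=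
  add_lt_add (waveVelocity_lt_right hx hs h) (waveVelocity_lt_right hy hs h)

/-- The middle density is where the strictly decreasing function `waveVelocity κ γ x + waveVelocity
κ γ r.1` takes the value `r.2`, so a bound on it reduces to a comparison at one density. This
criterion and `middleDensity_lt` carry uniqueness, monotonicity and continuity of the middle
density. -/
lemma lt_middleDensity {x t : ℝ} {r : State} (hx : 0 < x) (hr : 0 < r.1) (ht : 0 ≤ t)
    (h : r.2 < waveVelocity κ γ x t + waveVelocity κ γ r.1 t) : t < middleDensity κ γ x r := by
  have hT : Tendsto (fun s => waveVelocity κ γ x s + waveVelocity κ γ r.1 s) atTop atBot :=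
    (tendsto_waveVelocity_atTop hx).atBot_add_atBot (tendsto_waveVelocity_atTop hr)
  obtain ⟨T, hT1, hT2⟩ := ((hT.eventually (eventually_le_atBot r.2)).and
    (eventually_ge_atTop t)).exists
  obtain ⟨s, hs, hs'⟩ := intermediate_value_Icc' hT2
    ((continuous_waveVelocity_right (κ := κ) (γ := γ) hx).add
      (continuous_waveVelocity_right hr)).continuousOn ⟨hT1, h.le⟩
  have hts : t < s := lt_of_le_of_ne hs.1 (by rintro rfl; exact h.ne' hs')
  have hex : ∃ s, 0 < s ∧ 0 < x ∧ 0 < r.1 ∧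
      waveVelocity κ γ x s + waveVelocity κ γ r.1 s = r.2 :=
    ⟨s, ht.trans_lt hts, hx, hr, hs'⟩
  have hm : 0 < middleDensity κ γ x r := by
    rw [middleDensity, dif_pos hex]
    exact hex.choose_spec.1
  by_contra! hle
  have := (middleDensity_spec hm).2.2
  rcases hle.eq_or_lt with he | hlt
  · rw [he] at this; linarith
  · linarith [waveVelocity_add_lt (κ := κ) (γ := γ) hx hr hm.le hlt]

lemma middleDensity_lt {x t : ℝ} {r : State} (ht : 0 < t)
    (h : waveVelocity κ γ x t + waveVelocity κ γ r.1 t < r.2) : middleDensity κ γ x r < t := by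
  by_contra! hle
  obtain ⟨hx, hr, hm⟩ := middleDensity_spec (ht.trans_le hle)
  rcases hle.eq_or_lt with he | hlt
  · rw [← he] at hm; linarith
  · linarith [waveVelocity_add_lt (κ := κ) (γ := γ) hx hr ht.le hlt]

lemma middleDensity_eq {x s : ℝ} {r : State} (hx : 0 < x) (hr : 0 < r.1) (hs : 0 < s)
    (h : waveVelocity κ γ x s + waveVelocity κ γ r.1 s = r.2) : middleDensity κ γ x r = s := by
  refine le_antisymm ?_ (le_of_forall_lt_imp_le_of_dense fun t ht => ?_)
  · refine le_of_forall_gt_imp_ge_of_dense fun t ht => (middleDensity_lt (hs.trans ht) ?_).le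
    exact h ▸ waveVelocity_add_lt hx hr hs.le ht
  · rcases lt_or_ge t 0 with h0 | h0
    · exact h0.le.trans (middleDensity_nonneg _ _)
    · exact (lt_middleDensity hx hr h0 (h ▸ waveVelocity_add_lt hx hr h0 ht)).le

lemma middleDensity_eq_zero {x : ℝ} {r : State}
    (h : waveVelocity κ γ x 0 + waveVelocity κ γ r.1 0 ≤ r.2) : middleDensity κ γ x r = 0 := by
  by_contra hne
  have hpos := lt_of_le_of_ne (middleDensity_nonneg (κ := κ) (γ := γ) x r) (Ne.symm hne)
  obtain ⟨hx, hr, hm⟩ := middleDensity_spec hpos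
  linarith [waveVelocity_add_lt (κ := κ) (γ := γ) hx hr le_rfl hpos]

lemma le_of_middleDensity_eq_zero {x : ℝ} {r : State} (hx : 0 < x) (hr : 0 < r.1)
    (h : middleDensity κ γ x r = 0) :
    waveVelocity κ γ x 0 + waveVelocity κ γ r.1 0 ≤ r.2 := by
  by_contra! hlt
  exact (lt_middleDensity hx hr le_rfl hlt).ne' h

lemma middleDensity_left_zero (r : State) : middleDensity κ γ 0 r = 0 := by
  refine le_antisymm (not_lt.1 fun h => ?_) (middleDensity_nonneg _ _)
  exact lt_irrefl _ (middleDensity_spec h).1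

lemma middleDensity_right_zero {x : ℝ} {r : State} (hr : r.1 = 0) :
    middleDensity κ γ x r = 0 := by
  refine le_antisymm (not_lt.1 fun h => ?_) (middleDensity_nonneg _ _)
  exact (middleDensity_spec h).2.1.ne' hr

/-- The middle state of the Riemann problem with left state `(x, 0)` and right state `r`. -/
def middleState (κ γ x : ℝ) (r : State) : State :=
  if middleDensity κ γ x r = 0 then (0, 0)
  else (middleDensity κ γ x r, waveVelocity κ γ x (middleDensity κ γ x r))

lemma middleState_mem_D (x : ℝ) (r : State) : middleState κ γ x r ∈ D := by
  unfold middleState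
  split_ifs with h
  · exact Or.inr rfl
  · exact Or.inl (lt_of_le_of_ne (middleDensity_nonneg _ _) (Ne.symm h))

/-! ### The Lax solution -/

/-- The smallest speed of the 1-wave. -/
def speedA (κ γ x : ℝ) (r : State) : ℝ := headSpeed κ γ (x, 0) (middleDensity κ γ x r)

/-- The largest speed of the 1-wave. -/
def speedB (κ γ x : ℝ) (r : State) : ℝ := tailSpeed κ γ (x, 0) (middleDensity κ γ x r)

/-- The smallest speed of the 2-wave. -/
def speedC (κ γ x : ℝ) (r : State) : ℝ :=
  if r.1 = 0 then speedB κ γ x r else -tailSpeed κ γ (reflect r) (middleDensity κ γ x r)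

/-- The largest speed of the 2-wave. -/
def speedD (κ γ x : ℝ) (r : State) : ℝ :=
  if r.1 = 0 then speedB κ γ x r else -headSpeed κ γ (reflect r) (middleDensity κ γ x r)

/-- The profile of the Lax solution with left state `(x, 0)` and right state `r`. -/
def laxProfile (κ γ x : ℝ) (r : State) (ξ : ℝ) : State :=
  if speedD κ γ x r ≤ ξ then r
  else if speedC κ γ x r ≤ ξ then fan2 κ γ (omega1 κ γ r) ξ
  else if speedB κ γ x r ≤ ξ then middleState κ γ x r
  else if speedA κ γ x r ≤ ξ then fan1 κ γ (omega2 κ γ (x, 0)) ξ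
  else (x, 0)

lemma speedA_le_speedB (x : ℝ) (r : State) : speedA κ γ x r ≤ speedB κ γ x r :=
  headSpeed_le_tailSpeed (middleDensity_nonneg _ _)

lemma speedC_le_speedD (x : ℝ) (r : State) : speedC κ γ x r ≤ speedD κ γ x r := by
  unfold speedC speedD
  split_ifs
  · exact le_rfl
  · exact neg_le_neg (headSpeed_le_tailSpeed (middleDensity_nonneg _ _))

lemma left_mem_D {x : ℝ} (hx : 0 ≤ x) : ((x, 0) : State) ∈ D := by
  rcases hx.eq_or_lt with rfl | h
  · exact Or.inr rfl
  · exact Or.inl h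

lemma fst_pos_or_eq_zero {r : State} (hr : r ∈ D) : 0 < r.1 ∨ r = (0, 0) := hr

lemma laxProfile_mem_D {x : ℝ} {r : State} (hx : 0 ≤ x) (hr : r ∈ D) (ξ : ℝ) :
    laxProfile κ γ x r ξ ∈ D := by
  unfold laxProfile
  split_ifs
  exacts [hr, fan2_mem_D _ _, middleState_mem_D _ _, fan1_mem_D _ _, left_mem_D hx]

section Sectors

variable {x ξ : ℝ} {r : State}

lemma laxProfile_of_speedD_le (h : speedD κ γ x r ≤ ξ) : laxProfile κ γ x r ξ = r := if_pos h

lemma laxProfile_of_mem_Ico_speedC (h : ξ ∈ Ico (speedC κ γ x r) (speedD κ γ x r)) :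
    laxProfile κ γ x r ξ = fan2 κ γ (omega1 κ γ r) ξ := by
  rw [laxProfile, if_neg h.2.not_ge, if_pos h.1]

lemma laxProfile_of_mem_Ico_speedB (h : ξ ∈ Ico (speedB κ γ x r) (speedC κ γ x r)) :
    laxProfile κ γ x r ξ = middleState κ γ x r := by
  rw [laxProfile, if_neg (h.2.trans_le (speedC_le_speedD x r)).not_ge, if_neg h.2.not_ge,
    if_pos h.1]

lemma laxProfile_of_mem_Ico_speedA (h : ξ ∈ Ico (speedA κ γ x r) (speedB κ γ x r))
    (h' : ξ < speedC κ γ x r) :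
    laxProfile κ γ x r ξ = fan1 κ γ (omega2 κ γ (x, 0)) ξ := by
  rw [laxProfile, if_neg (h'.trans_le (speedC_le_speedD x r)).not_ge, if_neg h'.not_ge,
    if_neg h.2.not_ge, if_pos h.1]

lemma laxProfile_of_lt_speedA (h : ξ < speedA κ γ x r) (h' : ξ < speedC κ γ x r) :
    laxProfile κ γ x r ξ = (x, 0) := by
  rw [laxProfile, if_neg (h'.trans_le (speedC_le_speedD x r)).not_ge, if_neg h'.not_ge,
    if_neg (h.trans_le (speedA_le_speedB x r)).not_ge, if_neg h.not_ge]

lemma eq_laxProfile_of_sectors {V : ℝ → State}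
    (hD : ∀ ξ > speedD κ γ x r, V ξ = r)
    (hC : ∀ ξ ∈ Ioo (speedC κ γ x r) (speedD κ γ x r), V ξ = fan2 κ γ (omega1 κ γ r) ξ)
    (hB : ∀ ξ ∈ Ioo (speedB κ γ x r) (speedC κ γ x r), V ξ = middleState κ γ x r)
    (hA : ∀ ξ ∈ Ioo (speedA κ γ x r) (speedB κ γ x r), ξ < speedC κ γ x r →
      V ξ = fan1 κ γ (omega2 κ γ (x, 0)) ξ)
    (hl : ∀ ξ < speedA κ γ x r, ξ < speedC κ γ x r → V ξ = (x, 0))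
    (h : ξ ∉ ({speedA κ γ x r, speedB κ γ x r, speedC κ γ x r, speedD κ γ x r} : Set ℝ)) :
    V ξ = laxProfile κ γ x r ξ := by
  simp only [mem_insert_iff, mem_singleton_iff, not_or] at h
  obtain ⟨h1, h2, h3, h4⟩ := h
  rcases lt_or_gt_of_ne h4 with h4 | h4
  swap
  · rw [hD ξ h4, laxProfile_of_speedD_le h4.le]
  rcases lt_or_gt_of_ne h3 with h3 | h3
  swap
  · rw [hC ξ ⟨h3, h4⟩, laxProfile_of_mem_Ico_speedC ⟨h3.le, h4⟩]
  rcases lt_or_gt_of_ne h2 with h2 | h2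
  swap
  · rw [hB ξ ⟨h2, h3⟩, laxProfile_of_mem_Ico_speedB ⟨h2.le, h3⟩]
  rcases lt_or_gt_of_ne h1 with h1 | h1
  · rw [hl ξ h1 h3, laxProfile_of_lt_speedA h1 h3]
  · rw [hA ξ ⟨h1, h2⟩ h3, laxProfile_of_mem_Ico_speedA ⟨h1.le, h2⟩ h3]

end Sectors

/-! ### Values of the speeds -/

section Speeds

variable {x : ℝ} {r : State}

lemma speedA_of_middle_zero (hx : 0 ≤ x) (hs : middleDensity κ γ x r = 0) :
    speedA κ γ x r = lambda1 κ γ (x, 0) := by rw [speedA, hs, headSpeed_zero hx]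

lemma speedB_of_middle_zero (hx : 0 ≤ x) (hs : middleDensity κ γ x r = 0) :
    speedB κ γ x r = omega2 κ γ (x, 0) := by rw [speedB, hs, tailSpeed_zero hx]

lemma speedC_of_middle_zero (hr : 0 < r.1) (hs : middleDensity κ γ x r = 0) :
    speedC κ γ x r = omega1 κ γ r := by
  rw [speedC, hs, if_neg hr.ne', tailSpeed_zero (by exact hr.le), omega2_reflect, neg_neg]

lemma speedD_of_middle_zero (hr : 0 < r.1) (hs : middleDensity κ γ x r = 0) :
    speedD κ γ x r = lambda2 κ γ r := by
  rw [speedD, hs, if_neg hr.ne', headSpeed_zero (by exact hr.le), lambda1_reflect, neg_neg]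

lemma speedB_le_speedC (hx : 0 < x) (hr : r ∈ D) : speedB κ γ x r ≤ speedC κ γ x r := by
  rcases fst_pos_or_eq_zero hr with hr | rfl
  · rcases (middleDensity_nonneg (κ := κ) (γ := γ) x r).eq_or_lt with hs | hs
    · rw [speedB_of_middle_zero hx.le hs.symm, speedC_of_middle_zero hr hs.symm]
      have := le_of_middleDensity_eq_zero hx hr hs.symm
      rw [waveVelocity_zero hx.le, waveVelocity_zero hr.le] at this
      simp only [omega2, omega1]
      linarith
    · have h1 := tailSpeed_lt (κ := κ) (γ := γ) (l := (x, 0)) hx hs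
      have h2 := tailSpeed_lt (κ := κ) (γ := γ) (l := reflect r) hr hs
      have h3 := (middleDensity_spec hs).2.2
      simp only [reflect_fst, reflect_snd] at h1 h2
      rw [speedB, speedC, if_neg hr.ne']
      linarith
  · simp [speedC]

end Speeds

/-! ### Existence of the Lax solution, and its uniqueness off finitely many speeds -/

lemma left_vacuum_eq (w : ℝ) : lambda1 κ γ (0, w) = w ∧ omega2 κ γ (0, w) = w := by
  simp [lambda1, omega2, zero_rpow_theta]

lemma middleState_of_zero {x : ℝ} {r : State} (h : middleDensity κ γ x r = 0) :
    middleState κ γ x r = (0, 0) := if_pos h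

/-- For `x = 0` the value of `speedB` is `0`, while the 2-fan may begin at a negative speed, so the
sectors can be out of order. The profile tests the sectors from the right, hence the 2-wave takes
precedence and vacuum remains to its left. -/
lemma laxProfile_left_vacuum {r : State} {ξ : ℝ} (h : ξ < speedC κ γ 0 r) :
    laxProfile κ γ 0 r ξ = (0, 0) := by
  have hs := middleDensity_left_zero (κ := κ) (γ := γ) r
  rcases le_or_gt (speedB κ γ 0 r) ξ with hB | hB
  · rw [laxProfile_of_mem_Ico_speedB ⟨hB, h⟩, middleState_of_zero hs]
  · refine laxProfile_of_lt_speedA ?_ h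
    rw [speedB_of_middle_zero le_rfl hs, (left_vacuum_eq 0).2] at hB
    rwa [speedA_of_middle_zero le_rfl hs, (left_vacuum_eq 0).1]

theorem isLaxSolution_laxProfile {x : ℝ} {r : State} (hx : 0 ≤ x) (hr : r ∈ D) :
    IsLaxSolution κ γ (x, 0) r (laxProfile κ γ x r) := by
  refine ⟨laxProfile_mem_D hx hr, ?_⟩
  rcases (middleDensity_nonneg (κ := κ) (γ := γ) x r).eq_or_lt with hs | hs
  · right
    replace hs := hs.symm
    have hright : ∀ v, (0 < r.1 → v = speedC κ γ x r) → (r = (0, 0) → v = speedD κ γ x r) →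
        IsRightOfVacuum κ γ r v (laxProfile κ γ x r) := by
      intro v h1 h2
      rcases fst_pos_or_eq_zero hr with hr | rfl
      · left
        rw [h1 hr, speedC_of_middle_zero hr hs]
        refine ⟨hr, rfl, fun ξ hξ => ?_, (isFan2_iff le_rfl).2 fun ξ hξ => ?_⟩
        · exact laxProfile_of_speedD_le (by rw [speedD_of_middle_zero hr hs]; exact hξ.le)
        · refine laxProfile_of_mem_Ico_speedC ?_
          rw [speedD_of_middle_zero hr hs, speedC_of_middle_zero hr hs]
          exact ⟨hξ.1.le, hξ.2⟩
      · right
        refine ⟨rfl, fun ξ hξ => laxProfile_of_speedD_le ?_⟩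
        rw [← h2 rfl]; exact hξ.le
    rcases hx.eq_or_lt with rfl | hx
    -- No 1-wave is present, so both edges of the vacuum sector are put at the start of the 2-wave.
    · refine ⟨speedC κ γ 0 r, speedC κ γ 0 r, le_rfl, Or.inr ⟨rfl, fun ξ hξ => ?_⟩,
        hright _ (fun _ => rfl) ?_, by simp⟩
      · exact laxProfile_left_vacuum hξ
      · rintro rfl; simp [speedC, speedD]
    · have hBC := speedB_le_speedC (κ := κ) (γ := γ) hx hr
      refine ⟨speedB κ γ x r, speedC κ γ x r, hBC, Or.inl ⟨hx, ?_, fun ξ hξ => ?_, ?_⟩,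
        hright _ (fun _ => rfl) ?_, fun ξ hξ => ?_⟩
      · exact speedB_of_middle_zero hx.le hs
      · rw [← speedA_of_middle_zero hx.le hs] at hξ
        exact laxProfile_of_lt_speedA hξ
          (hξ.trans_le ((speedA_le_speedB x r).trans hBC))
      · refine (isFan1_iff (speedB_of_middle_zero hx.le hs).le).2 fun ξ hξ => ?_
        rw [← speedA_of_middle_zero hx.le hs] at hξ
        exact laxProfile_of_mem_Ico_speedA ⟨hξ.1.le, hξ.2⟩ (hξ.2.trans_le hBC)
      · rintro rfl; simp [speedC, speedD]
      · rw [laxProfile_of_mem_Ico_speedB ⟨hξ.1.le, hξ.2⟩, middleState_of_zero hs]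
  · left
    obtain ⟨hx, hr0, hm⟩ := middleDensity_spec hs
    have hBC := speedB_le_speedC (κ := κ) (γ := γ) hx hr
    have hms : middleState κ γ x r
      = (middleDensity κ γ x r, waveVelocity κ γ x (middleDensity κ γ x r)) := if_neg hs.ne'
    refine ⟨middleState κ γ x r, speedA κ γ x r, speedB κ γ x r, speedC κ γ x r, speedD κ γ x r,
      hBC, isWave1_iff.2 ?_, isWave2_iff.2 ?_, fun ξ hξ => ?_, fun ξ hξ => ?_, fun ξ hξ => ?_⟩
    · rw [hms]
      refine ⟨hx, hs, by simp, rfl, rfl, fun ξ hξ => ?_⟩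
      exact laxProfile_of_mem_Ico_speedA ⟨hξ.1.le, hξ.2⟩ (hξ.2.trans_le hBC)
    · rw [hms]
      refine ⟨hr0, hs, by simp only; linarith, if_neg hr0.ne', if_neg hr0.ne', fun ξ hξ => ?_⟩
      exact laxProfile_of_mem_Ico_speedC ⟨hξ.1.le, hξ.2⟩
    · exact laxProfile_of_lt_speedA hξ (hξ.trans_le ((speedA_le_speedB x r).trans hBC))
    · exact laxProfile_of_mem_Ico_speedB ⟨hξ.1.le, hξ.2⟩
    · exact laxProfile_of_speedD_le hξ.le

theorem IsLaxSolution.eq_laxProfile {x : ℝ} {r : State} {V : ℝ → State}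
    (hV : IsLaxSolution κ γ (x, 0) r V) :
    ∃ S : Set ℝ, S.Finite ∧ ∀ ξ ∉ S, V ξ = laxProfile κ γ x r ξ := by
  rcases hV.2 with ⟨m, α₁, β₁, α₂, β₂, hle, h1, h2, hl, hm, hr⟩ | ⟨v₁, v₂, hle, hl, hr, hm⟩
  · obtain ⟨hx, hm0, hu1, rfl, rfl, hf1⟩ := isWave1_iff.1 h1
    obtain ⟨hr0, -, hu2, rfl, rfl, hf2⟩ := isWave2_iff.1 h2
    simp only [zero_add] at hu1 hx
    have hs : middleDensity κ γ x r = m.1 :=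
      middleDensity_eq hx hr0 hm0 (by linarith)
    have hms : middleState κ γ x r = m := by
      rw [middleState, hs, if_neg hm0.ne']
      exact Prod.ext rfl hu1.symm
    have hA : speedA κ γ x r = headSpeed κ γ (x, 0) m.1 := by rw [speedA, hs]
    have hB : speedB κ γ x r = tailSpeed κ γ (x, 0) m.1 := by rw [speedB, hs]
    have hC : speedC κ γ x r = -tailSpeed κ γ (reflect r) m.1 := by
      rw [speedC, hs, if_neg hr0.ne']
    have hD : speedD κ γ x r = -headSpeed κ γ (reflect r) m.1 := by
      rw [speedD, hs, if_neg hr0.ne']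
    rw [← hA, ← hB] at hf1
    rw [← hC, ← hD] at hf2
    rw [← hB, ← hC, ← hms] at hm
    rw [← hA] at hl
    rw [← hD] at hr
    exact ⟨_, toFinite _, fun ξ hξ => eq_laxProfile_of_sectors hr hf2 hm
      (fun ξ hξ _ => hf1 ξ hξ) (fun ξ hξ _ => hl ξ hξ) hξ⟩
  · rcases hl with ⟨hx, rfl, hl, hfl⟩ | ⟨hx, hl⟩
    · simp only at hx
      have hfl' := (isFan1_iff le_rfl).1 hfl
      rcases hr with ⟨hr0, rfl, hr, hfr⟩ | ⟨rfl, hr⟩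
      · have hfr' := (isFan2_iff le_rfl).1 hfr
        have hs : middleDensity κ γ x r = 0 := by
          refine middleDensity_eq_zero ?_
          rw [waveVelocity_zero hx.le, waveVelocity_zero hr0.le]
          simp only [omega1, omega2] at hle
          linarith
        rw [← middleState_of_zero hs, ← speedB_of_middle_zero hx.le hs,
          ← speedC_of_middle_zero hr0 hs] at hm
        rw [← speedA_of_middle_zero hx.le hs] at hl hfl'
        rw [← speedB_of_middle_zero hx.le hs] at hfl'
        rw [← speedD_of_middle_zero hr0 hs] at hr hfr'
        rw [← speedC_of_middle_zero hr0 hs] at hfr'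
        refine ⟨_, toFinite _, fun ξ hξ => eq_laxProfile_of_sectors hr
          (fun ξ hξ => ?_) hm
          (fun ξ hξ _ => ?_) (fun ξ hξ _ => hl ξ hξ) hξ⟩
        · rw [hfr' ξ hξ, speedC_of_middle_zero hr0 hs]
        · rw [hfl' ξ hξ, speedB_of_middle_zero hx.le hs]
      · have hs : middleDensity κ γ x (0, 0) = 0 := middleDensity_right_zero rfl
        have hB := speedB_of_middle_zero hx.le hs
        have hC : speedC κ γ x (0, 0) = omega2 κ γ (x, 0) := by simp [speedC, hB]
        have hD : speedD κ γ x (0, 0) = omega2 κ γ (x, 0) := by simp [speedD, hB]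
        -- With vacuum on the right, `v₂` is an arbitrary speed inside the vacuum region where `V`
        -- is not prescribed, so it joins the exceptional set.
        refine ⟨{speedA κ γ x (0, 0), speedB κ γ x (0, 0), speedC κ γ x (0, 0),
          speedD κ γ x (0, 0)} ∪ {v₂}, toFinite _, fun ξ hξ => ?_⟩
        rw [mem_union, not_or, mem_singleton_iff] at hξ
        obtain ⟨hξ, hv⟩ := hξ
        by_cases hgt : speedD κ γ x (0, 0) < ξ
        · rw [laxProfile_of_speedD_le hgt.le]
          rcases lt_or_gt_of_ne hv with hv | hv
          · exact hm ξ ⟨by rwa [← hD], hv⟩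
          · exact hr ξ hv
        · have hlt : ξ < speedC κ γ x (0, 0) := by
            rw [hC, ← hD]
            exact lt_of_le_of_ne (not_lt.1 hgt) fun h => by simp [h] at hξ
          rcases lt_or_ge ξ (speedA κ γ x (0, 0)) with hA | hA
          · rw [laxProfile_of_lt_speedA hA hlt]
            exact hl ξ (by rwa [← speedA_of_middle_zero hx.le hs])
          · have hlt' : ξ < speedB κ γ x (0, 0) := by rwa [hB, ← hC]
            rw [laxProfile_of_mem_Ico_speedA ⟨hA, hlt'⟩ hlt]
            refine hfl' ξ ⟨?_, by rwa [← hC]⟩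
            rw [← speedA_of_middle_zero hx.le hs]
            exact lt_of_le_of_ne hA fun h => by simp [h] at hξ
    · obtain rfl : x = 0 := congrArg Prod.fst hx
      have hs := middleDensity_left_zero (κ := κ) (γ := γ) r
      refine ⟨{v₁, v₂, speedC κ γ 0 r, speedD κ γ 0 r}, toFinite _, fun ξ hξ => ?_⟩
      simp only [mem_insert_iff, mem_singleton_iff, not_or] at hξ
      obtain ⟨h1, h2, h3, h4⟩ := hξ
      have hvac : ξ < v₂ → V ξ = (0, 0) := fun h => by
        rcases lt_or_gt_of_ne h1 with h1 | h1
        · exact hl ξ h1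
        · exact hm ξ ⟨h1, h⟩
      rcases hr with ⟨hr0, rfl, hr, hfr⟩ | ⟨rfl, hr⟩
      · have hfr' := (isFan2_iff le_rfl).1 hfr
        have hC := speedC_of_middle_zero hr0 hs
        have hD := speedD_of_middle_zero hr0 hs
        rcases lt_or_gt_of_ne h2 with h2 | h2
        · rw [hvac h2, laxProfile_left_vacuum (hC ▸ h2)]
        · rcases lt_or_gt_of_ne h4 with h4 | h4
          · rw [laxProfile_of_mem_Ico_speedC ⟨by rw [hC]; exact h2.le, h4⟩]
            exact hfr' ξ ⟨h2, by rwa [← hD]⟩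
          · rw [laxProfile_of_speedD_le h4.le]
            exact hr ξ (by rwa [← hD])
      · have hz : laxProfile κ γ 0 (0, 0) ξ = (0, 0) := by
          rcases le_or_gt (speedD κ γ 0 (0, 0)) ξ with h | h
          · exact laxProfile_of_speedD_le h
          · exact laxProfile_left_vacuum (by simpa [speedC, speedD] using h)
        rw [hz]
        rcases lt_or_gt_of_ne h2 with h2 | h2
        · exact hvac h2
        · exact hr ξ h2

/-! ### Dependence of the middle density on the left density -/

lemma middleDensity_lt_middleDensity {x y : ℝ} {r : State} (hxy : x < y)
    (h : middleDensity κ γ y r ≠ 0) : middleDensity κ γ x r < middleDensity κ γ y r := by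
  have hpos := lt_of_le_of_ne (middleDensity_nonneg (κ := κ) (γ := γ) y r) (Ne.symm h)
  rcases (middleDensity_nonneg (κ := κ) (γ := γ) x r).eq_or_lt with h0 | h0
  · rwa [← h0]
  · obtain ⟨hx, hr, hm⟩ := middleDensity_spec h0
    refine lt_middleDensity (hx.trans hxy) hr h0.le ?_
    linarith [waveVelocity_lt_left (κ := κ) (γ := γ) hx h0.le hxy]

lemma middleDensity_mono {x y : ℝ} {r : State} (hxy : x ≤ y) :
    middleDensity κ γ x r ≤ middleDensity κ γ y r := by
  rcases hxy.eq_or_lt with rfl | hlt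
  · exact le_rfl
  by_cases h : middleDensity κ γ y r = 0
  · rcases (middleDensity_nonneg (κ := κ) (γ := γ) x r).eq_or_lt with h0 | h0
    · rw [← h0, h]
    · obtain ⟨hx, hr, hm⟩ := middleDensity_spec h0
      refine (lt_middleDensity (hx.trans hlt) hr h0.le ?_).le
      linarith [waveVelocity_lt_left (κ := κ) (γ := γ) hx h0.le hlt]
  · exact (middleDensity_lt_middleDensity hlt h).le

/-- A strict bound on the middle density at `x₀` is a strict inequality between wave velocities,
which persists for nearby `x`. At `x₀ = 0` the blow-up `tendsto_waveVelocity_zero` replaces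
continuity. -/
lemma continuousOn_middleDensity {r : State} (hr : 0 < r.1) :
    ContinuousOn (fun x => middleDensity κ γ x r) (Ici 0) := by
  intro x₀ (hx₀ : 0 ≤ x₀)
  rcases hx₀.eq_or_lt with rfl | hx₀
  · rw [ContinuousWithinAt, middleDensity_left_zero]
    refine tendsto_order.2 ⟨fun a ha => ?_, fun a ha => ?_⟩
    · exact Eventually.of_forall fun x => ha.trans_le (middleDensity_nonneg _ _)
    · have h : ∀ᶠ x in 𝓝[>] (0 : ℝ), middleDensity κ γ x r < a := by
        filter_upwards [(tendsto_waveVelocity_zero (κ := κ) (γ := γ) ha).eventually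
          (eventually_lt_atBot (r.2 - waveVelocity κ γ r.1 a))] with x hx
        exact middleDensity_lt ha (by linarith)
      rw [← Ioi_insert, nhdsWithin_insert, eventually_sup, eventually_pure]
      exact ⟨by rwa [middleDensity_left_zero], h⟩
  · refine ContinuousAt.continuousWithinAt (tendsto_order.2 ⟨fun a ha => ?_, fun a ha => ?_⟩)
    · rcases lt_or_ge a 0 with h0 | h0
      · exact Eventually.of_forall fun x => h0.trans_le (middleDensity_nonneg _ _)
      · obtain ⟨-, -, hm⟩ := middleDensity_spec (h0.trans_lt ha)
        have hc := (continuousOn_waveVelocity_left (κ := κ) (γ := γ) h0).continuousAt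
          (Ioi_mem_nhds hx₀)
        have hlt := waveVelocity_add_lt (κ := κ) (γ := γ) hx₀ hr h0 ha
        filter_upwards [hc.eventually_const_lt
          (show r.2 - waveVelocity κ γ r.1 a < _ by linarith), Ioi_mem_nhds hx₀] with x h1 h2
        exact lt_middleDensity h2 hr h0 (by linarith)
    · have ha0 := (middleDensity_nonneg (κ := κ) (γ := γ) x₀ r).trans_lt ha
      have hc := (continuousOn_waveVelocity_left (κ := κ) (γ := γ) ha0.le).continuousAt
          (Ioi_mem_nhds hx₀)
      have hlt : waveVelocity κ γ x₀ a + waveVelocity κ γ r.1 a < r.2 := by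
        have h := waveVelocity_add_lt (κ := κ) (γ := γ) hx₀ hr (middleDensity_nonneg x₀ r) ha
        rcases (middleDensity_nonneg (κ := κ) (γ := γ) x₀ r).eq_or_lt with h0 | h0
        · rw [← h0] at h
          linarith [le_of_middleDensity_eq_zero hx₀ hr h0.symm]
        · linarith [(middleDensity_spec h0).2.2]
      filter_upwards [hc.eventually_lt_const
          (show _ < r.2 - waveVelocity κ γ r.1 a by linarith)] with x h1
      exact middleDensity_lt ha0 (by linarith)

/-! ### The 2-wave curve through the right state -/

/-- The velocity on the 2-wave curve through the right state `r` at density `s`. -/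
def backVelocity (κ γ : ℝ) (r : State) (s : ℝ) : ℝ := r.2 - waveVelocity κ γ r.1 s

/-- The momentum on the 2-wave curve through the right state `r` at density `s`. -/
def backMomentum (κ γ : ℝ) (r : State) (s : ℝ) : ℝ := s * backVelocity κ γ r s

/-- The density at which `λ₂` vanishes on the 2-rarefaction curve through `r`. -/
def backSonic (κ γ : ℝ) (r : State) : ℝ := fanDensity κ γ (-omega1 κ γ r)

/-- The momentum at speed `0` of the 2-wave between density `s` and the right state `r`. -/
def backFlux (κ γ : ℝ) (r : State) (s : ℝ) : ℝ :=
  max (backMomentum κ γ r (max s r.1)) (momentum r) - momentum r +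
    backMomentum κ γ r (min r.1 (max s (backSonic κ γ r)))

section Back

variable {r : State} {s t : ℝ}

lemma backVelocity_lt (hr : 0 < r.1) (hs : 0 ≤ s) (h : s < t) :
    backVelocity κ γ r s < backVelocity κ γ r t :=
  sub_lt_sub_left (waveVelocity_lt_right hr hs h) _

lemma backVelocity_le (hr : 0 < r.1) (hs : 0 ≤ s) (h : s ≤ t) :
    backVelocity κ γ r s ≤ backVelocity κ γ r t := by
  rcases h.eq_or_lt with rfl | h
  · exact le_rfl
  · exact (backVelocity_lt hr hs h).le

lemma continuous_backVelocity (hr : 0 < r.1) : Continuous (backVelocity κ γ r) :=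
  continuous_const.sub (continuous_waveVelocity_right hr)

lemma continuous_backMomentum (hr : 0 < r.1) : Continuous (backMomentum κ γ r) :=
  continuous_id.mul (continuous_backVelocity hr)

lemma continuous_backFlux (hr : 0 < r.1) : Continuous (backFlux κ γ r) := by
  have h := continuous_backMomentum (κ := κ) (γ := γ) hr
  unfold backFlux
  fun_prop

lemma backVelocity_self : backVelocity κ γ r r.1 = r.2 := by
  rw [backVelocity, waveVelocity_self, sub_zero]

lemma backMomentum_self : backMomentum κ γ r r.1 = momentum r := by
  rw [backMomentum, backVelocity_self, momentum]

lemma backVelocity_of_le (h : s ≤ r.1) :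
    backVelocity κ γ r s = omega1 κ γ r + aCoeff κ γ * s ^ theta γ := by
  rw [backVelocity, waveVelocity_of_le h, omega1]; ring

/-- The last factor is the speed of the 2-shock, so this is the first Rankine-Hugoniot condition. -/
lemma backMomentum_of_gt (hr : 0 < r.1) (h : r.1 < s) :
    backMomentum κ γ r s = momentum r + (s - r.1) * (r.2 + massFlux κ γ r.1 s / r.1) := by
  have hs := hr.trans h
  rw [backMomentum, backVelocity, waveVelocity_of_lt h, velocityJump_eq hr h, momentum]
  field_simp; ring

/-- On the rarefaction branch the momentum has derivative `λ₂` in the density, nonnegative above the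
sonic density. The proof uses the tangent inequality for the power `1 + θ` instead of derivatives.
-/
lemma backMomentum_mono_of_le (hs : 0 ≤ s) (h0 : backSonic κ γ r ≤ s) (hst : s ≤ t)
    (ht : t ≤ r.1) : backMomentum κ γ r s ≤ backMomentum κ γ r t := by
  have ha := aCoeff_pos (κ := κ) (γ := γ)
  have hc := aCoeff_mul_theta (κ := κ) (γ := γ)
  rw [backSonic, fanDensity_le_iff hs] at h0
  rw [backMomentum, backMomentum, backVelocity_of_le ht, backVelocity_of_le (hst.trans ht)]
  rcases hs.eq_or_lt with rfl | hs
  · rw [zero_rpow_theta, mul_zero] at h0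
    rw [zero_mul]
    exact mul_nonneg hst (add_nonneg (by linarith) (by positivity))
  · have htan := rpow_tangent_le (p := 1 + theta γ) (by linarith [theta_pos (γ := γ)]) hs
      (hs.le.trans hst)
    rw [Real.rpow_add hs, Real.rpow_one, Real.rpow_add (hs.trans_le hst), Real.rpow_one,
      add_sub_cancel_left] at htan
    have h1 := mul_le_mul_of_nonneg_left htan ha.le
    have h2 := mul_le_mul_of_nonneg_right h0 (sub_nonneg.2 hst)
    rw [← hc] at h2
    linarith

/-- The excess over `momentum r` is `(s - r.1)` times the shock speed; once it is positive, both
factors are, and both increase with `s`. -/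
lemma max_backMomentum_mono (hr : 0 < r.1) (hs : r.1 ≤ s) (hst : s ≤ t) :
    max (backMomentum κ γ r s) (momentum r) ≤ max (backMomentum κ γ r t) (momentum r) := by
  rcases hs.eq_or_lt with rfl | hs
  · rw [backMomentum_self, max_self]; exact le_max_right _ _
  refine max_le ?_ (le_max_right _ _)
  rcases le_or_gt (backMomentum κ γ r s) (momentum r) with h | h
  · exact h.trans (le_max_right _ _)
  refine le_trans ?_ (le_max_left _ _)
  rw [backMomentum_of_gt hr hs] at h ⊢
  rw [backMomentum_of_gt hr (hs.trans_le hst)]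
  have hJ := massFlux_le (κ := κ) (γ := γ) hr hs hst
  have hpos : 0 < r.2 + massFlux κ γ r.1 s / r.1 :=
    pos_of_mul_pos_right (by linarith) (sub_pos.2 hs).le
  have : 0 ≤ t - r.1 := by linarith
  gcongr

lemma backSonic_nonneg : 0 ≤ backSonic κ γ r := fanDensity_nonneg _

/-- The first summand varies only for `s > r.1` (shock) and the second only for `s < r.1`
(rarefaction); each is nondecreasing. -/
lemma backFlux_mono (hr : 0 < r.1) (hs : 0 ≤ s) (hst : s ≤ t) :
    backFlux κ γ r s ≤ backFlux κ γ r t := by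
  unfold backFlux
  have h1 := max_backMomentum_mono (κ := κ) (γ := γ) hr (le_max_right s r.1)
    (max_le_max_right r.1 hst)
  have h2 : backMomentum κ γ r (min r.1 (max s (backSonic κ γ r))) ≤
      backMomentum κ γ r (min r.1 (max t (backSonic κ γ r))) := by
    rcases le_or_gt (backSonic κ γ r) r.1 with h | h
    · refine backMomentum_mono_of_le (le_min hr.le (le_max_of_le_left hs))
        (le_min h (le_max_right _ _)) (min_le_min_left _ (max_le_max_right _ hst)) (min_le_left _ _)
    · rw [min_eq_left (le_max_of_le_right h.le), min_eq_left (le_max_of_le_right h.le)]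
  linarith

/-- At speed `0` one sees the middle state if the 2-shock moves right and `r` otherwise; by the jump
condition this is always the larger momentum. -/
lemma backFlux_of_ge (h : r.1 ≤ s) :
    backFlux κ γ r s = max (backMomentum κ γ r s) (momentum r) := by
  rw [backFlux, max_eq_left h, min_eq_left (le_max_of_le_left h), backMomentum_self]; ring

/-- The density seen at speed `0` in a 2-rarefaction is the sonic one, clamped to the range from `s`
to `r.1`. -/
lemma backFlux_of_le (h : s ≤ r.1) :
    backFlux κ γ r s = backMomentum κ γ r (min r.1 (max s (backSonic κ γ r))) := by
  rw [backFlux, max_eq_right h, backMomentum_self]; simp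

lemma backFlux_of_nonneg (hr : 0 < r.1) (hs : 0 ≤ s) (h : 0 ≤ backVelocity κ γ r s) :
    backFlux κ γ r s = backMomentum κ γ r s := by
  have hc := sqrt_mul_pos (κ := κ) (γ := γ)
  rcases le_or_gt r.1 s with hrs | hsr
  · rw [backFlux_of_ge hrs, max_eq_left]
    have h1 := backVelocity_le (κ := κ) (γ := γ) hr hr.le hrs
    rw [backVelocity_self] at h1
    rw [backMomentum, momentum]
    calc r.1 * r.2 ≤ r.1 * backVelocity κ γ r s := by gcongr
      _ ≤ _ := by gcongr
  · rw [backFlux_of_le hsr.le, max_eq_left, min_eq_right hsr.le]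
    rw [backSonic, fanDensity_le_iff hs]
    rw [backVelocity_of_le hsr.le] at h
    have : 0 ≤ √(κ * γ) * s ^ theta γ := by positivity
    linarith

lemma neg_omega1_eq (h : omega1 κ γ r ≤ 0) :
    -omega1 κ γ r = (aCoeff κ γ + √(κ * γ)) * backSonic κ γ r ^ theta γ := by
  have ha := aCoeff_add_pos (κ := κ) (γ := γ)
  rw [backSonic, fanDensity_rpow, max_eq_left (by linarith)]; field_simp

lemma omega1_neg (hr : 0 < r.1) (hs : 0 ≤ s) (h : backVelocity κ γ r s < 0) :
    omega1 κ γ r < 0 := by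
  have h0 := backVelocity_le (κ := κ) (γ := γ) hr le_rfl hs
  rw [backVelocity_of_le hr.le, zero_rpow_theta, mul_zero, add_zero] at h0
  linarith

/-- Each state that can be seen at speed `0` (middle, sonic or `r`) then has positive density and
negative velocity. -/
lemma backFlux_neg (hr : 0 < r.1) (hs : 0 ≤ s) (h : backVelocity κ γ r s < 0) :
    backFlux κ γ r s < 0 := by
  have hc := sqrt_mul_pos (κ := κ) (γ := γ)
  rcases le_or_gt r.1 s with hrs | hsr
  · rw [backFlux_of_ge hrs]
    have h1 := backVelocity_le (κ := κ) (γ := γ) hr hr.le hrs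
    rw [backVelocity_self] at h1
    exact max_lt (mul_neg_of_pos_of_neg (hr.trans_le hrs) h)
      (mul_neg_of_pos_of_neg hr (by linarith))
  · rw [backFlux_of_le hsr.le]
    have hω := omega1_neg hr hs h
    have h0 : 0 < backSonic κ γ r := fanDensity_pos (by linarith)
    have hpos : 0 < min r.1 (max s (backSonic κ γ r)) := lt_min hr (lt_max_of_lt_right h0)
    refine mul_neg_of_pos_of_neg hpos ?_
    have hsonic : omega1 κ γ r + aCoeff κ γ * backSonic κ γ r ^ theta γ < 0 := by
      have := neg_omega1_eq hω.le
      have : 0 < √(κ * γ) * backSonic κ γ r ^ theta γ := by positivity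
      linarith
    have hmax : omega1 κ γ r + aCoeff κ γ * (max s (backSonic κ γ r)) ^ theta γ < 0 := by
      rcases max_choice s (backSonic κ γ r) with e | e <;> rw [e]
      · rwa [backVelocity_of_le hsr.le] at h
      · exact hsonic
    rw [backVelocity_of_le (min_le_left _ _)]
    have := mul_le_mul_of_nonneg_left (rpow_theta_le (γ := γ) hpos.le
      (min_le_right r.1 (max s (backSonic κ γ r)))) (aCoeff_pos (κ := κ) (γ := γ)).le
    linarith

end Back

/-! ### The mass flux at the junction -/

/-- The sonic density of the 1-rarefaction starting from `(x, 0)`. -/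
def sonicDensity (κ γ x : ℝ) : ℝ := fanDensity κ γ (aCoeff κ γ * x ^ theta γ)

/-- The sonic velocity of the 1-rarefaction starting from `(x, 0)`. -/
def sonicVelocity (κ γ x : ℝ) : ℝ := √(κ * γ) * sonicDensity κ γ x ^ theta γ

/-- The mass flux at speed `0` of the Lax solution with left state `(x, 0)` and right state `r`. -/
def traceFlux (κ γ : ℝ) (r : State) (x : ℝ) : ℝ :=
  if r.1 = 0 then sonicDensity κ γ x * sonicVelocity κ γ x
  else max (middleDensity κ γ x r) (sonicDensity κ γ x) *
      min (max (backVelocity κ γ r (middleDensity κ γ x r)) 0) (sonicVelocity κ γ x) +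
    min (backFlux κ γ r (middleDensity κ γ x r)) 0

section Trace

variable {x y : ℝ} {r : State}

lemma sonicDensity_nonneg : 0 ≤ sonicDensity κ γ x := fanDensity_nonneg _

lemma sonicVelocity_nonneg : 0 ≤ sonicVelocity κ γ x :=
  mul_nonneg (Real.sqrt_nonneg _) (Real.rpow_nonneg sonicDensity_nonneg _)

lemma sonicDensity_zero : sonicDensity κ γ 0 = 0 := by
  rw [sonicDensity, zero_rpow_theta, mul_zero, fanDensity_of_nonpos le_rfl]

lemma sonicVelocity_zero : sonicVelocity κ γ 0 = 0 := by
  rw [sonicVelocity, sonicDensity_zero, zero_rpow_theta, mul_zero]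

lemma continuous_sonicDensity : Continuous (sonicDensity κ γ) :=
  continuous_fanDensity.comp (continuous_const.mul continuous_rpow_theta)

lemma continuous_sonicVelocity : Continuous (sonicVelocity κ γ) :=
  continuous_const.mul (continuous_rpow_theta.comp continuous_sonicDensity)

lemma sonicDensity_rpow (hx : 0 ≤ x) :
    (aCoeff κ γ + √(κ * γ)) * sonicDensity κ γ x ^ theta γ = aCoeff κ γ * x ^ theta γ := by
  have ha := aCoeff_add_pos (κ := κ) (γ := γ)
  have ha' := aCoeff_pos (κ := κ) (γ := γ)
  rw [sonicDensity, fanDensity_rpow, max_eq_left (by positivity)]; field_simp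

lemma sonicDensity_lt (hx : 0 ≤ x) (h : x < y) : sonicDensity κ γ x < sonicDensity κ γ y := by
  by_contra! hle
  have h1 := rpow_theta_le (γ := γ) sonicDensity_nonneg hle
  have h2 := mul_le_mul_of_nonneg_left h1 (aCoeff_add_pos (κ := κ) (γ := γ)).le
  rw [sonicDensity_rpow hx, sonicDensity_rpow (hx.trans h.le)] at h2
  have h3 := mul_lt_mul_of_pos_left (rpow_theta_lt (γ := γ) hx h) (aCoeff_pos (κ := κ) (γ := γ))
  linarith

lemma sonicDensity_pos (hx : 0 < x) : 0 < sonicDensity κ γ x := by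
  have := sonicDensity_lt (κ := κ) (γ := γ) le_rfl hx
  rwa [sonicDensity_zero] at this

lemma sonicVelocity_pos (hx : 0 < x) : 0 < sonicVelocity κ γ x :=
  mul_pos sqrt_mul_pos (Real.rpow_pos_of_pos (sonicDensity_pos hx) _)

lemma sonicVelocity_le (hx : 0 ≤ x) (h : x ≤ y) : sonicVelocity κ γ x ≤ sonicVelocity κ γ y := by
  rcases h.eq_or_lt with rfl | h
  · exact le_rfl
  · exact mul_le_mul_of_nonneg_left (rpow_theta_le sonicDensity_nonneg (sonicDensity_lt hx h).le)
      (Real.sqrt_nonneg _)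

/-- Without vacuum both sides are the middle velocity; with vacuum the inequality says that the two
fans do not overlap. -/
lemma waveVelocity_le_backVelocity (hx : 0 < x) (hr : 0 < r.1) :
    waveVelocity κ γ x (middleDensity κ γ x r) ≤
      backVelocity κ γ r (middleDensity κ γ x r) := by
  rw [backVelocity]
  rcases (middleDensity_nonneg (κ := κ) (γ := γ) x r).eq_or_lt with h0 | h0
  · have := le_of_middleDensity_eq_zero hx hr h0.symm
    rw [← h0]; linarith
  · linarith [(middleDensity_spec h0).2.2]

/-! ### Continuity, sign and monotonicity of the flux at the junction -/

lemma continuousOn_traceFlux (hr : r ∈ D) : ContinuousOn (traceFlux κ γ r) (Ici 0) := by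
  unfold traceFlux
  rcases fst_pos_or_eq_zero hr with hr | rfl
  · simp only [hr.ne', if_false]
    have hm := continuousOn_middleDensity (κ := κ) (γ := γ) hr
    refine ContinuousOn.add (ContinuousOn.mul ?_ ?_) ?_
    · exact hm.sup continuous_sonicDensity.continuousOn
    · exact (((continuous_backVelocity hr).comp_continuousOn hm).sup continuousOn_const).inf
        continuous_sonicVelocity.continuousOn
    · exact ((continuous_backFlux hr).comp_continuousOn hm).inf continuousOn_const
  · simp only [if_true]
    exact (continuous_sonicDensity.mul continuous_sonicVelocity).continuousOn

lemma traceFlux_zero_nonpos : traceFlux κ γ r 0 ≤ 0 := by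
  unfold traceFlux
  split_ifs
  · rw [sonicDensity_zero, zero_mul]
  · rw [sonicVelocity_zero, min_eq_right (le_max_right _ _), mul_zero, zero_add]
    exact min_le_right _ _

lemma min_backFlux_of_nonneg (hr : 0 < r.1) {s : ℝ} (hs : 0 ≤ s)
    (h : 0 ≤ backVelocity κ γ r s) : min (backFlux κ γ r s) 0 = 0 := by
  rw [backFlux_of_nonneg hr hs h]
  exact min_eq_right (mul_nonneg hs h)

lemma traceFlux_mono (hr : r ∈ D) (hx : 0 ≤ x) (h : x < y) :
    traceFlux κ γ r x ≤ traceFlux κ γ r y := by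
  have h1 := (sonicDensity_lt (κ := κ) (γ := γ) hx h).le
  have h2 := sonicVelocity_le (κ := κ) (γ := γ) hx h.le
  have h3 := sonicDensity_nonneg (κ := κ) (γ := γ) (x := y)
  have h4 := sonicVelocity_nonneg (κ := κ) (γ := γ) (x := x)
  unfold traceFlux
  rcases fst_pos_or_eq_zero hr with hr | rfl
  · simp only [hr.ne', if_false]
    have hm := middleDensity_mono (κ := κ) (γ := γ) (r := r) h.le
    have hn := middleDensity_nonneg (κ := κ) (γ := γ) x r
    have hu := backVelocity_le (κ := κ) (γ := γ) hr hn hm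
    have hf := backFlux_mono (κ := κ) (γ := γ) hr hn hm
    refine add_le_add (mul_le_mul (max_le_max hm h1) (min_le_min (max_le_max_right _ hu) h2)
      (le_min (le_max_right _ _) h4) (le_max_of_le_right h3)) (min_le_min_right _ hf)
  · simp only [if_true]
    exact mul_le_mul h1 h2 h4 h3

/-- Strictness can fail only where the flux is negative: there `r` itself or the sonic point of its
2-curve may be seen, whatever `x` is. -/
lemma traceFlux_lt (hr : r ∈ D) (hx : 0 ≤ x) (h : x < y) (hy : 0 ≤ traceFlux κ γ r y) :
    traceFlux κ γ r x < traceFlux κ γ r y := by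
  have hy0 := hx.trans_lt h
  have h1 := sonicDensity_lt (κ := κ) (γ := γ) hx h
  have h2 := sonicVelocity_le (κ := κ) (γ := γ) hx h.le
  have h3 := sonicDensity_nonneg (κ := κ) (γ := γ) (x := x)
  have h4 := sonicVelocity_nonneg (κ := κ) (γ := γ) (x := x)
  have h5 := sonicVelocity_pos (κ := κ) (γ := γ) hy0
  unfold traceFlux at hy ⊢
  rcases fst_pos_or_eq_zero hr with hr | rfl
  · simp only [hr.ne', if_false] at hy ⊢
    have hm := middleDensity_mono (κ := κ) (γ := γ) (r := r) h.le
    have hm' := middleDensity_lt_middleDensity (κ := κ) (γ := γ) (r := r) h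
    have hW := waveVelocity_le_backVelocity (κ := κ) (γ := γ) hy0 hr
    have hn := middleDensity_nonneg (κ := κ) (γ := γ) x r
    set s := middleDensity κ γ x r
    set t := middleDensity κ γ y r
    have hu := backVelocity_le (κ := κ) (γ := γ) hr hn hm
    have ht : 0 ≤ t := hn.trans hm
    have hut : 0 ≤ backVelocity κ γ r t := by
      by_contra! hneg
      rw [max_eq_right hneg.le, min_eq_left h5.le, mul_zero, zero_add,
        min_eq_left (backFlux_neg hr ht hneg).le] at hy
      exact hy.not_gt (backFlux_neg hr ht hneg)
    rw [min_backFlux_of_nonneg hr ht hut, add_zero]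
    rcases hut.eq_or_lt with h0 | hpos
    -- Vacuum is excluded, since it would give a velocity of at least `a_γ y ^ θ > 0`. So the middle
    -- density grows strictly, and its velocity at `x` lies strictly below `0`.
    · have hst : s < t := by
        refine hm' fun h00 => ?_
        rw [h00, waveVelocity_zero hy0.le, ← h00, ← h0] at hW
        have := mul_pos (aCoeff_pos (κ := κ) (γ := γ)) (Real.rpow_pos_of_pos hy0 (theta γ))
        linarith
      have hus := backVelocity_lt (κ := κ) (γ := γ) hr hn hst
      rw [← h0] at hus
      rw [← h0, max_self, min_eq_left h5.le, mul_zero, max_eq_right hus.le, min_eq_left h4,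
        mul_zero, zero_add]
      exact min_lt_of_left_lt (backFlux_neg hr hn hus)
    -- The density factor grows strictly even when the middle state is vacuum, because the sonic
    -- density does; the velocity factor at `y` is positive.
    · have hmax : max s (sonicDensity κ γ x) < max t (sonicDensity κ γ y) := by
        by_cases h00 : t = 0
        · rw [h00, max_eq_right (h3.trans h1.le), le_antisymm (h00 ▸ hm) hn, max_eq_right h3]
          exact h1
        · exact max_lt_max (hm' h00) h1
      have hA : max s (sonicDensity κ γ x) *
          min (max (backVelocity κ γ r s) 0) (sonicVelocity κ γ x) <
          max t (sonicDensity κ γ y) *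
          min (max (backVelocity κ γ r t) 0) (sonicVelocity κ γ y) :=
        (mul_le_mul_of_nonneg_left (min_le_min (max_le_max_right _ hu) h2)
          (le_max_of_le_right h3)).trans_lt
          (mul_lt_mul_of_pos_right hmax (lt_min (lt_max_of_lt_left hpos) h5))
      linarith [min_le_right (backFlux κ γ r s) 0]
  · simp only [if_true]
    exact (mul_le_mul_of_nonneg_left h2 h3).trans_lt (mul_lt_mul_of_pos_right h1 h5)

lemma lt_middleDensity_of_backVelocity_neg (hx : 0 < x) (hr : 0 < r.1)
    (h : backVelocity κ γ r (middleDensity κ γ x r) < 0) : x < middleDensity κ γ x r :=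
  (waveVelocity_neg_iff hx (middleDensity_nonneg _ _)).1
    ((waveVelocity_le_backVelocity hx hr).trans_lt h)

/-- A negative middle velocity needs a 1-shock, hence a middle density above `x`, where the
increasing velocity on the 2-curve is already positive. -/
lemma traceFlux_nonneg (hx : 0 < x) (h : 0 < r.1 → 0 ≤ backVelocity κ γ r x) (hr : r ∈ D) :
    0 ≤ traceFlux κ γ r x := by
  have h3 := sonicDensity_nonneg (κ := κ) (γ := γ) (x := x)
  have h4 := sonicVelocity_nonneg (κ := κ) (γ := γ) (x := x)
  unfold traceFlux
  rcases fst_pos_or_eq_zero hr with hr | rfl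
  · have hs := middleDensity_nonneg (κ := κ) (γ := γ) x r
    have hu : 0 ≤ backVelocity κ γ r (middleDensity κ γ x r) := by
      by_contra! hneg
      have := backVelocity_lt (κ := κ) (γ := γ) hr hx.le
        (lt_middleDensity_of_backVelocity_neg hx hr hneg)
      linarith [h hr]
    rw [if_neg hr.ne', min_backFlux_of_nonneg hr hs hu, add_zero]
    exact mul_nonneg (le_max_of_le_left hs) (le_min (le_max_right _ _) h4)
  · simp only [if_true]
    positivity

lemma eventually_traceFlux_nonneg (hr : r ∈ D) : ∀ᶠ x in atTop, 0 ≤ traceFlux κ γ r x := by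
  rcases fst_pos_or_eq_zero hr with hr0 | rfl
  · filter_upwards [eventually_gt_atTop 0,
      (tendsto_waveVelocity_atTop (κ := κ) (γ := γ) hr0).eventually (eventually_le_atBot r.2)]
      with x hx h
    exact traceFlux_nonneg hx (fun _ => sub_nonneg.2 h) hr
  · filter_upwards [eventually_gt_atTop 0] with x hx
    exact traceFlux_nonneg hx (fun h => absurd h (lt_irrefl _)) hr

/-! ### Identification of `traceFlux` with the momentum of the profile at speed `0` -/

lemma fan1_left_zero (hx : 0 < x) :
    fan1 κ γ (omega2 κ γ (x, 0)) 0 = (sonicDensity κ γ x, sonicVelocity κ γ x) := by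
  have h : omega2 κ γ (x, 0) = aCoeff κ γ * x ^ theta γ := by simp [omega2]
  have hpos : 0 < aCoeff κ γ * x ^ theta γ :=
    mul_pos aCoeff_pos (Real.rpow_pos_of_pos hx _)
  simp [fan1, h, hpos, sonicVelocity, sonicDensity]

lemma fan2_zero (h : omega1 κ γ r < 0) : fan2 κ γ (omega1 κ γ r) 0 =
    (backSonic κ γ r, -(√(κ * γ) * backSonic κ γ r ^ theta γ)) := by
  simp [fan2, fan1, h, backSonic, reflect]

lemma headSpeed_left_nonpos (hx : 0 < x) {s : ℝ} : headSpeed κ γ (x, 0) s ≤ 0 := by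
  unfold headSpeed
  split_ifs
  · simp only [lambda1, zero_sub, neg_nonpos]
    positivity
  · simp only [zero_sub, neg_nonpos]
    exact div_nonneg (Real.sqrt_nonneg _) hx.le

lemma backVelocity_le_speedC (hr : 0 < r.1) :
    backVelocity κ γ r (middleDensity κ γ x r) ≤ speedC κ γ x r := by
  rcases (middleDensity_nonneg (κ := κ) (γ := γ) x r).eq_or_lt with h0 | h0
  · rw [speedC_of_middle_zero hr h0.symm, ← h0, backVelocity_of_le hr.le, zero_rpow_theta,
      mul_zero, add_zero]
  · have h2 := tailSpeed_lt (κ := κ) (γ := γ) (l := reflect r) hr h0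
    simp only [reflect_fst, reflect_snd] at h2
    rw [speedC, if_neg hr.ne', backVelocity]
    linarith

lemma backVelocity_lt_speedD (hr : 0 < r.1) :
    backVelocity κ γ r (middleDensity κ γ x r) < speedD κ γ x r := by
  have ha := aCoeff_add_pos (κ := κ) (γ := γ)
  rcases (middleDensity_nonneg (κ := κ) (γ := γ) x r).eq_or_lt with h0 | h0
  · rw [speedD_of_middle_zero hr h0.symm, ← h0, backVelocity_of_le hr.le, zero_rpow_theta,
      mul_zero, add_zero, omega1, lambda2]
    have : 0 < (aCoeff κ γ + √(κ * γ)) * r.1 ^ theta γ := by positivity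
    linarith
  · refine lt_of_lt_of_le ?_ (speedC_le_speedD x r)
    have h2 := tailSpeed_lt (κ := κ) (γ := γ) (l := reflect r) hr h0
    simp only [reflect_fst, reflect_snd] at h2
    rw [speedC, if_neg hr.ne', backVelocity]
    linarith

lemma momentum_laxProfile_of_vacuum (hx : 0 ≤ x) :
    momentum (laxProfile κ γ x (0, 0) 0) = traceFlux κ γ (0, 0) x := by
  have hs : middleDensity κ γ x (0, 0) = 0 := middleDensity_right_zero rfl
  have hB := speedB_of_middle_zero hx hs
  rcases hx.eq_or_lt with rfl | hx
  · have hD : speedD κ γ 0 (0, 0) = 0 := by simp [speedD, hB, (left_vacuum_eq (κ := κ) (γ := γ) 0).2]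
    rw [laxProfile_of_speedD_le hD.le]
    simp [momentum, traceFlux, sonicDensity_zero]
  · have hpos : 0 < omega2 κ γ (x, 0) := by
      simp only [omega2, zero_add]
      exact mul_pos aCoeff_pos (Real.rpow_pos_of_pos hx _)
    rw [laxProfile_of_mem_Ico_speedA ⟨headSpeed_left_nonpos hx, by rwa [hB]⟩
      (by simpa [speedC, hB] using hpos), fan1_left_zero hx]
    simp [momentum, traceFlux]

/-- A nonnegative middle velocity keeps the 2-wave to the right of speed `0`, apart from a
degenerate vacuum case, and for `x > 0` makes any middle state the end of a 1-rarefaction. Speed `0`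
then shows the middle state or the sonic state, according to which has the larger density; on the
1-rarefaction this also has the smaller velocity. -/
lemma momentum_laxProfile_of_nonneg (hx : 0 ≤ x) (hr : 0 < r.1)
    (hu : 0 ≤ backVelocity κ γ r (middleDensity κ γ x r)) :
    momentum (laxProfile κ γ x r 0) = traceFlux κ γ r x := by
  have hs := middleDensity_nonneg (κ := κ) (γ := γ) x r
  have hC := backVelocity_le_speedC (κ := κ) (γ := γ) (x := x) hr
  have hD := backVelocity_lt_speedD (κ := κ) (γ := γ) (x := x) hr
  rw [traceFlux, if_neg hr.ne', min_backFlux_of_nonneg hr hs hu, add_zero, max_eq_left hu]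
  rcases le_or_gt (speedC κ γ x r) 0 with hC0 | hC0
  -- Here `0 ≤ u ≤ speedC ≤ 0`. A middle state of positive density would make `u < speedC` strict,
  -- so there is vacuum, `ω₁(r) = 0`, and the edge of the 2-fan sits at speed `0`.
  · have hu0 : backVelocity κ γ r (middleDensity κ γ x r) = 0 := by linarith
    have hω : 0 ≤ omega1 κ γ r := by
      rcases hs.eq_or_lt with h0 | h0
      · rw [← h0, backVelocity_of_le hr.le, zero_rpow_theta] at hu0
        linarith
      · have h2 := tailSpeed_lt (κ := κ) (γ := γ) (l := reflect r) hr h0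
        simp only [reflect_fst, reflect_snd] at h2
        rw [speedC, if_neg hr.ne'] at hC0
        rw [backVelocity] at hu
        linarith
    rw [laxProfile_of_mem_Ico_speedC ⟨hC0, by linarith⟩, fan2_of_le hω, hu0,
      min_eq_left sonicVelocity_nonneg]
    simp [momentum]
  rcases hx.eq_or_lt with rfl | hx
  · rw [laxProfile_left_vacuum hC0, sonicVelocity_zero, min_eq_right hu]
    simp [momentum]
  have hson := sonicDensity_rpow (κ := κ) (γ := γ) hx.le
  have ha := aCoeff_pos (κ := κ) (γ := γ)
  have hac := aCoeff_add_pos (κ := κ) (γ := γ)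
  have hW := waveVelocity_le_backVelocity (κ := κ) (γ := γ) hx hr
  rcases le_or_gt (speedB κ γ x r) 0 with hB0 | hB0
  · rw [laxProfile_of_mem_Ico_speedB ⟨hB0, hC0⟩]
    have hpos : 0 < middleDensity κ γ x r := by
      refine lt_of_le_of_ne hs fun h0 => hB0.not_gt ?_
      rw [speedB_of_middle_zero hx.le h0.symm]
      simp only [omega2, zero_add]
      exact mul_pos ha (Real.rpow_pos_of_pos hx _)
    have hm := (middleDensity_spec hpos).2.2
    have hWu : waveVelocity κ γ x (middleDensity κ γ x r) =
        backVelocity κ γ r (middleDensity κ γ x r) := by rw [backVelocity]; linarith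
    have hsx : middleDensity κ γ x r ≤ x := by
      by_contra! hlt
      have := (waveVelocity_neg_iff (κ := κ) (γ := γ) hx hs).2 hlt
      linarith
    rw [speedB, tailSpeed, if_pos hsx] at hB0
    have hWa := waveVelocity_of_le (κ := κ) (γ := γ) hsx
    simp only [zero_add] at hB0
    have hle : sonicDensity κ γ x ≤ middleDensity κ γ x r := by
      rw [sonicDensity, fanDensity_le_iff hs]
      linarith
    have hle' := mul_le_mul_of_nonneg_left
      (rpow_theta_le (γ := γ) sonicDensity_nonneg hle) ha.le
    rw [max_eq_left hle, min_eq_left]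
    · simp [momentum, middleState, hpos.ne', hWu]
    · rw [← hWu, sonicVelocity]; linarith
  · rw [laxProfile_of_mem_Ico_speedA ⟨headSpeed_left_nonpos hx, hB0⟩ hC0, fan1_left_zero hx]
    have hsx : middleDensity κ γ x r ≤ x := by
      by_contra! hlt
      rw [speedB, tailSpeed, if_neg hlt.not_ge] at hB0
      have := div_pos (massFlux_pos (κ := κ) (γ := γ) hx hlt) hx
      simp only at hB0
      linarith
    rw [speedB, tailSpeed, if_pos hsx] at hB0
    have hWa := waveVelocity_of_le (κ := κ) (γ := γ) hsx
    simp only [zero_add] at hB0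
    have hle : middleDensity κ γ x r ≤ sonicDensity κ γ x := by
      refine (rpow_theta_le_iff (γ := γ) hs sonicDensity_nonneg).1
        (le_of_mul_le_mul_left ?_ hac)
      linarith
    have hle' := mul_le_mul_of_nonneg_left (rpow_theta_le (γ := γ) hs hle) ha.le
    rw [max_eq_right hle, min_eq_right]
    · rfl
    · rw [sonicVelocity]; linarith

/-- When the middle density is positive, a negative middle velocity means a 1-shock of negative
speed; speed `0` then shows the middle state, a point of the 2-fan, or `r`. -/
lemma momentum_laxProfile_of_neg (hr : 0 < r.1)
    (hu : backVelocity κ γ r (middleDensity κ γ x r) < 0) :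
    momentum (laxProfile κ γ x r 0) = traceFlux κ γ r x := by
  have hs := middleDensity_nonneg (κ := κ) (γ := γ) x r
  have ha := aCoeff_pos (κ := κ) (γ := γ)
  have hac := aCoeff_add_pos (κ := κ) (γ := γ)
  have hω := omega1_neg hr hs hu
  have hω' := neg_omega1_eq hω.le
  rw [traceFlux, if_neg hr.ne', max_eq_right hu.le, min_eq_left sonicVelocity_nonneg, mul_zero,
    zero_add, min_eq_left (backFlux_neg hr hs hu).le]
  have hmid : 0 < speedC κ γ x r → 0 < middleDensity κ γ x r →
      momentum (laxProfile κ γ x r 0) = backMomentum κ γ r (middleDensity κ γ x r) := by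
    intro hC h0
    obtain ⟨hx, -, hm⟩ := middleDensity_spec h0
    have hlt := lt_middleDensity_of_backVelocity_neg hx hr hu
    have hB : speedB κ γ x r ≤ 0 := by
      rw [speedB, tailSpeed, if_neg hlt.not_ge]
      have := div_pos (massFlux_pos (κ := κ) (γ := γ) hx hlt) hx
      simp only
      linarith
    rw [laxProfile_of_mem_Ico_speedB ⟨hB, hC⟩, middleState, if_neg h0.ne', momentum,
      backMomentum, backVelocity]
    simp only
    congr 1
    linarith
  rcases le_or_gt (middleDensity κ γ x r) r.1 with hsr | hsr
  · have hC : speedC κ γ x r =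
        omega1 κ γ r + (aCoeff κ γ + √(κ * γ)) * middleDensity κ γ x r ^ theta γ := by
      rw [speedC, if_neg hr.ne', tailSpeed, if_pos (by exact hsr)]
      have := backVelocity_of_le (κ := κ) (γ := γ) hsr
      rw [backVelocity] at this
      simp only [reflect_fst, reflect_snd]
      linarith
    have hD : speedD κ γ x r = omega1 κ γ r + (aCoeff κ γ + √(κ * γ)) * r.1 ^ theta γ := by
      rw [speedD, if_neg hr.ne', headSpeed, if_pos (by exact hsr), lambda1_reflect, lambda2, omega1]
      ring
    rw [backFlux_of_le hsr]
    rcases le_or_gt (speedD κ γ x r) 0 with hD0 | hD0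
    · rw [laxProfile_of_speedD_le hD0, min_eq_left, backMomentum_self]
      refine le_max_of_le_right ((rpow_theta_le_iff (γ := γ) hr.le backSonic_nonneg).1
        (le_of_mul_le_mul_left ?_ hac))
      linarith
    · have h0r : backSonic κ γ r ≤ r.1 := by
        rw [backSonic, fanDensity_le_iff hr.le]; linarith
      rcases le_or_gt (speedC κ γ x r) 0 with hC0 | hC0
      · have hs0 : middleDensity κ γ x r ≤ backSonic κ γ r :=
          (rpow_theta_le_iff (γ := γ) hs backSonic_nonneg).1
            (le_of_mul_le_mul_left (by linarith) hac)
        rw [laxProfile_of_mem_Ico_speedC ⟨hC0, hD0⟩, fan2_zero hω, max_eq_right hs0,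
          min_eq_right h0r, backMomentum, backVelocity_of_le h0r, momentum]
        simp only
        congr 1
        linarith
      · have hs0 : backSonic κ γ r ≤ middleDensity κ γ x r := by
          rw [backSonic, fanDensity_le_iff hs]; linarith
        rw [max_eq_left hs0, min_eq_right hsr]
        refine hmid hC0 (lt_of_lt_of_le (fanDensity_pos (by linarith)) hs0)
  · have hC : speedC κ γ x r = r.2 + massFlux κ γ r.1 (middleDensity κ γ x r) / r.1 := by
      rw [speedC, if_neg hr.ne', tailSpeed, if_neg (by exact hsr.not_ge)]
      simp only [reflect_fst, reflect_snd]
      ring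
    have hD : speedD κ γ x r = r.2 + massFlux κ γ r.1 (middleDensity κ γ x r) / r.1 := by
      rw [speedD, if_neg hr.ne', headSpeed, if_neg (by exact hsr.not_ge)]
      simp only [reflect_fst, reflect_snd]
      ring
    have hq := backMomentum_of_gt (κ := κ) (γ := γ) hr hsr
    rw [backFlux_of_ge hsr.le]
    rw [← hC] at hq
    rcases le_or_gt (speedC κ γ x r) 0 with hC0 | hC0
    · rw [laxProfile_of_speedD_le (by rwa [hD, ← hC]), max_eq_right]
      rw [hq]
      linarith [mul_nonpos_of_nonneg_of_nonpos (sub_pos.2 hsr).le hC0]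
    · rw [hmid hC0 (hr.trans hsr), max_eq_left]
      rw [hq]
      linarith [mul_pos (sub_pos.2 hsr) hC0]

theorem momentum_laxProfile (hx : 0 ≤ x) (hr : r ∈ D) :
    momentum (laxProfile κ γ x r 0) = traceFlux κ γ r x := by
  rcases fst_pos_or_eq_zero hr with hr | rfl
  · rcases le_or_gt 0 (backVelocity κ γ r (middleDensity κ γ x r)) with h | h
    · exact momentum_laxProfile_of_nonneg hx hr h
    · exact momentum_laxProfile_of_neg hr h
  · exact momentum_laxProfile_of_vacuum hx

/-! ### The trace of the Lax solution -/

/-- Near `0` from the right the test `b ≤ ξ` has the same outcome as at `0`; this is why the profile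
is built with non-strict tests. -/
lemma tendsto_ite_le {b : ℝ} {f g : ℝ → State} (hf : Tendsto f (𝓝[>] 0) (𝓝 (f 0)))
    (hg : Tendsto g (𝓝[>] 0) (𝓝 (g 0))) :
    Tendsto (fun ξ => if b ≤ ξ then f ξ else g ξ) (𝓝[>] 0) (𝓝 (if b ≤ 0 then f 0 else g 0)) := by
  rcases le_or_gt b 0 with h | h
  · rw [if_pos h]
    refine hf.congr' ?_
    filter_upwards [self_mem_nhdsWithin] with ξ hξ
    rw [if_pos (h.trans (le_of_lt hξ))]
  · rw [if_neg h.not_ge]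
    refine hg.congr' ?_
    filter_upwards [Ioo_mem_nhdsGT h] with ξ hξ
    rw [if_neg hξ.2.not_ge]

lemma tendsto_fan1 (w : ℝ) : Tendsto (fan1 κ γ w) (𝓝[>] 0) (𝓝 (fan1 κ γ w 0)) := by
  rcases le_or_gt w 0 with h | h
  · rw [fan1_of_le h]
    refine tendsto_const_nhds.congr' ?_
    filter_upwards [self_mem_nhdsWithin] with ξ hξ
    rw [fan1_of_le (h.trans (le_of_lt hξ))]
  · have hc : Continuous fun ξ => ((fanDensity κ γ (w - ξ),
        ξ + √(κ * γ) * fanDensity κ γ (w - ξ) ^ theta γ) : State) := by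
      have h1 : Continuous fun ξ => fanDensity κ γ (w - ξ) :=
        continuous_fanDensity.comp (continuous_const.sub continuous_id)
      exact h1.prodMk (continuous_id.add (continuous_const.mul (continuous_rpow_theta.comp h1)))
    have h0 := (hc.tendsto 0).mono_left (nhdsWithin_le_nhds (s := Ioi 0))
    have e : ∀ ξ < w, ((fanDensity κ γ (w - ξ),
        ξ + √(κ * γ) * fanDensity κ γ (w - ξ) ^ theta γ) : State) = fan1 κ γ w ξ := by
      intro ξ hξ
      simp [fan1, hξ]
    rw [e 0 h] at h0
    refine h0.congr' ?_
    filter_upwards [Ioo_mem_nhdsGT h] with ξ hξ using e ξ hξ.2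

lemma tendsto_fan2 (w : ℝ) : Tendsto (fan2 κ γ w) (𝓝[>] 0) (𝓝 (fan2 κ γ w 0)) := by
  rcases lt_or_ge 0 w with h | h
  · rw [fan2_of_le h.le]
    refine tendsto_const_nhds.congr' ?_
    filter_upwards [Ioo_mem_nhdsGT h] with ξ hξ
    rw [fan2_of_le hξ.2.le]
  · have hc : Continuous fun ξ => ((fanDensity κ γ (ξ - w),
        ξ - √(κ * γ) * fanDensity κ γ (ξ - w) ^ theta γ) : State) := by
      have h1 : Continuous fun ξ => fanDensity κ γ (ξ - w) :=
        continuous_fanDensity.comp (continuous_id.sub continuous_const)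
      exact h1.prodMk (continuous_id.sub (continuous_const.mul (continuous_rpow_theta.comp h1)))
    have h0 := (hc.tendsto 0).mono_left (nhdsWithin_le_nhds (s := Ioi 0))
    have e : ∀ ξ > w, ((fanDensity κ γ (ξ - w),
        ξ - √(κ * γ) * fanDensity κ γ (ξ - w) ^ theta γ) : State) = fan2 κ γ w ξ := by
      intro ξ hξ
      have e1 : -w - -ξ = ξ - w := by ring
      simp only [fan2, fan1, reflect, neg_lt_neg_iff, if_pos hξ, e1]
      congr 1
      ring
    -- If `w = 0`, the fan formula still gives the vacuum at `ξ = 0`, since density and velocity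
    -- both vanish there.
    have e0 : ((fanDensity κ γ (0 - w),
        0 - √(κ * γ) * fanDensity κ γ (0 - w) ^ theta γ) : State) = fan2 κ γ w 0 := by
      rcases h.eq_or_lt with rfl | h
      · simp [fan2_of_le, fanDensity_of_nonpos, zero_rpow_theta]
      · exact e 0 h
    rw [e0] at h0
    refine h0.congr' ?_
    filter_upwards [self_mem_nhdsWithin] with ξ hξ using e ξ (lt_of_le_of_lt h hξ)

theorem tendsto_laxProfile (x : ℝ) (r : State) :
    Tendsto (laxProfile κ γ x r) (𝓝[>] 0) (𝓝 (laxProfile κ γ x r 0)) := by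
  unfold laxProfile
  exact tendsto_ite_le tendsto_const_nhds (tendsto_ite_le (tendsto_fan2 _)
    (tendsto_ite_le tendsto_const_nhds (tendsto_ite_le (tendsto_fan1 _) tendsto_const_nhds)))

end Trace

/-! ### The artificial density -/

lemma exists_sum_traceFlux_eq_zero {d : ℕ} {A : Fin d → ℝ} (hA : ∀ k, 0 < A k)
    {hat : Fin d → State} (hhat : ∀ k, hat k ∈ D) :
    ∃ x : ℝ, 0 ≤ x ∧ ∑ k, A k * traceFlux κ γ (hat k) x = 0 := by
  -- One density `X` at which the fluxes of all pipes are nonnegative.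
  obtain ⟨X, hX, hX0⟩ := ((eventually_all.2 fun k =>
    eventually_traceFlux_nonneg (κ := κ) (γ := γ) (hhat k)).and (eventually_ge_atTop 0)).exists
  have hc : ContinuousOn (fun x => ∑ k, A k * traceFlux κ γ (hat k) x) (Icc 0 X) :=
    continuousOn_finsetSum _ fun k _ => continuousOn_const.mul
      ((continuousOn_traceFlux (hhat k)).mono Icc_subset_Ici_self)
  obtain ⟨x, hx, hx'⟩ := intermediate_value_Icc hX0 hc
    ⟨Finset.sum_nonpos fun k _ => mul_nonpos_of_nonneg_of_nonpos (hA k).le traceFlux_zero_nonpos,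
      Finset.sum_nonneg fun k _ => mul_nonneg (hA k).le (hX k)⟩
  exact ⟨x, hx.1, hx'⟩

lemma sum_traceFlux_ne_of_lt {d : ℕ} (hd : 1 ≤ d) {A : Fin d → ℝ} (hA : ∀ k, 0 < A k)
    {hat : Fin d → State} (hhat : ∀ k, hat k ∈ D) {x y : ℝ} (hx : 0 ≤ x) (h : x < y)
    (hy : ∑ k, A k * traceFlux κ γ (hat k) y = 0) :
    ∑ k, A k * traceFlux κ γ (hat k) x ≠ 0 := by
  obtain ⟨k, hk⟩ : ∃ k, 0 ≤ traceFlux κ γ (hat k) y := by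
    by_contra! hneg
    refine (Finset.sum_neg (fun k _ => mul_neg_of_pos_of_neg (hA k) (hneg k)) ?_).ne hy
    exact ⟨⟨0, hd⟩, Finset.mem_univ _⟩
  rw [← hy]
  exact (Finset.sum_lt_sum (fun k _ => mul_le_mul_of_nonneg_left
    (traceFlux_mono (hhat k) hx h) (hA k).le) ⟨k, Finset.mem_univ _,
      mul_lt_mul_of_pos_left (traceFlux_lt (hhat k) hx h hk) (hA k)⟩).ne

lemma sum_traceFlux_unique {d : ℕ} (hd : 1 ≤ d) {A : Fin d → ℝ} (hA : ∀ k, 0 < A k)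
    {hat : Fin d → State} (hhat : ∀ k, hat k ∈ D) {x y : ℝ} (hx : 0 ≤ x) (hy : 0 ≤ y)
    (hx' : ∑ k, A k * traceFlux κ γ (hat k) x = 0)
    (hy' : ∑ k, A k * traceFlux κ γ (hat k) y = 0) : x = y := by
  rcases lt_trichotomy x y with h | h | h
  · exact absurd hx' (sum_traceFlux_ne_of_lt hd hA hhat hx h hy')
  · exact h
  · exact absurd hy' (sum_traceFlux_ne_of_lt hd hA hhat hy h hx')

/-! ### Self-similar functions on the quarter plane -/

/-- By Fubini: for each `t` only finitely many `x` lie on the finitely many rays. -/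
lemma ae_div_notMem {S : Set ℝ} (hS : S.Finite) :
    ∀ᵐ p : ℝ × ℝ ∂(volume.restrict (Ioi 0 ×ˢ Ioi 0)), p.2 / p.1 ∉ S := by
  rw [Measure.volume_eq_prod, ← Measure.prod_restrict]
  have hmeas : MeasurableSet {p : ℝ × ℝ | p.2 / p.1 ∉ S} :=
    (measurable_snd.div measurable_fst) hS.measurableSet.compl
  rw [Measure.ae_prod_iff_ae_ae hmeas]
  filter_upwards [ae_restrict_mem measurableSet_Ioi] with t ht
  refine ae_restrict_of_ae ?_
  have hfin : {x : ℝ | x / t ∈ S}.Finite :=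
    hS.preimage fun a _ b _ hab => (div_left_inj' (ne_of_gt ht)).1 hab
  filter_upwards [hfin.countable.ae_notMem volume] with x hx using hx

/-- Every interval `(0, ε)` has positive measure, so the functions agree at points arbitrarily close
to `0`. -/
lemma ae_tendsto_unique {f : ℝ → State} {g : ℝ → State} {a b : State}
    (h : ∀ᵐ x ∂(volume.restrict (Ioi (0 : ℝ))), f x = g x)
    (hf : Tendsto f (𝓝[>] 0) (𝓝 a)) (hg : Tendsto g (𝓝[>] 0) (𝓝 b)) : a = b := by
  have hfreq : ∃ᶠ x in 𝓝[>] (0 : ℝ), f x = g x := by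
    intro hne
    obtain ⟨ε, hε, hsub⟩ := mem_nhdsGT_iff_exists_Ioo_subset.1 hne
    have hzero : volume (Ioo (0 : ℝ) ε) = 0 := by
      rw [ae_restrict_iff' measurableSet_Ioi] at h
      refine measure_mono_null (fun x hx => ?_) (ae_iff.1 h)
      simp only [mem_ofPred_eq, Classical.not_imp]
      exact ⟨hx.1, hsub hx⟩
    simp only [Real.volume_Ioo, sub_zero, ENNReal.ofReal_eq_zero] at hzero
    exact (not_le.2 hε) hzero
  by_contra hab
  obtain ⟨u, v, hu, hv, ha, hb, huv⟩ := t2_separation hab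
  obtain ⟨x, hx, h1, h2⟩ := (hfreq.and_eventually
    ((hf.eventually (hu.mem_nhds ha)).and (hg.eventually (hv.mem_nhds hb)))).exists
  exact disjoint_left.1 huv h1 (hx ▸ h2)

lemma tendsto_div_nhdsGT {t : ℝ} (ht : 0 < t) :
    Tendsto (fun x : ℝ => x / t) (𝓝[>] 0) (𝓝[>] 0) := by
  refine tendsto_nhdsWithin_iff.2 ⟨?_, ?_⟩
  · have := ((continuous_id (X := ℝ)).div_const t).tendsto 0
    simp only [id, zero_div] at this
    exact this.mono_left nhdsWithin_le_nhds
  · filter_upwards [self_mem_nhdsWithin] with x hx using div_pos hx ht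

section Junction

variable {d : ℕ} {A : Fin d → ℝ} {hat : Fin d → State} {ρs : ℝ}

lemma IsGeneralizedRiemannSolution.ae_eq_laxProfile {U : Fin d → ℝ → ℝ → State}
    (hU : IsGeneralizedRiemannSolution κ γ A hat ρs U) (k : Fin d) :
    ∀ᵐ p : ℝ × ℝ ∂(volume.restrict (Ioi 0 ×ˢ Ioi 0)),
      U k p.1 p.2 = laxProfile κ γ ρs (hat k) (p.2 / p.1) := by
  obtain ⟨V, hV, hUV⟩ := hU.lax k
  obtain ⟨S, hS, hVS⟩ := hV.eq_laxProfile
  filter_upwards [hUV, ae_div_notMem hS] with p h1 h2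
  rw [h1, hVS _ h2]

/-- Almost every `t` has both the traces of `U` and equality with the profile for almost every `x`;
one such `t` identifies the traces with the profile at speed `0`. -/
lemma IsGeneralizedRiemannSolution.sum_traceFlux (hhat : ∀ k, hat k ∈ D)
    {U : Fin d → ℝ → ℝ → State} (hU : IsGeneralizedRiemannSolution κ γ A hat ρs U) :
    ∑ k, A k * traceFlux κ γ (hat k) ρs = 0 := by
  have hae : ∀ k, ∀ᵐ t ∂(volume.restrict (Ioi (0 : ℝ))), ∀ᵐ x ∂(volume.restrict (Ioi (0 : ℝ))),
      U k t x = laxProfile κ γ ρs (hat k) (x / t) := by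
    intro k
    have := hU.ae_eq_laxProfile k
    rw [Measure.volume_eq_prod, ← Measure.prod_restrict] at this
    exact Measure.ae_ae_of_ae_prod this
  have hne : (ae (volume.restrict (Ioi (0 : ℝ)))).NeBot := by
    rw [ae_neBot]
    simp [Measure.restrict_eq_zero]
  obtain ⟨t, ht, hall, bar, hbar, hsum⟩ :=
    ((ae_restrict_mem measurableSet_Ioi).and ((eventually_all.2 hae).and hU.mass)).exists
  rw [← hsum]
  refine Finset.sum_congr rfl fun k _ => ?_
  have : bar k = laxProfile κ γ ρs (hat k) 0 :=
    ae_tendsto_unique (hall k) (hbar k).2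
      ((tendsto_laxProfile ρs (hat k)).comp (tendsto_div_nhdsGT ht))
  rw [← momentum_laxProfile hU.density_nonneg (hhat k), ← this, momentum]

lemma isGeneralizedRiemannSolution_laxProfile (hhat : ∀ k, hat k ∈ D) (hρ : 0 ≤ ρs)
    (hsum : ∑ k, A k * traceFlux κ γ (hat k) ρs = 0) :
    IsGeneralizedRiemannSolution κ γ A hat ρs
      fun k t x => laxProfile κ γ ρs (hat k) (x / t) where
  mem_D k t _ x _ := laxProfile_mem_D hρ (hhat k) _
  initial k x hx := by
    refine tendsto_const_nhds.congr' ?_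
    have h : Tendsto (fun t : ℝ => x / t) (𝓝[>] 0) atTop :=
      tendsto_inv_nhdsGT_zero.const_mul_atTop hx
    filter_upwards [h.eventually (eventually_ge_atTop (speedD κ γ ρs (hat k)))] with t ht
    rw [laxProfile_of_speedD_le ht]
  density_nonneg := hρ
  lax k := ⟨_, isLaxSolution_laxProfile hρ (hhat k), Eventually.of_forall fun _ => rfl⟩
  mass := by
    filter_upwards [ae_restrict_mem measurableSet_Ioi] with t ht
    refine ⟨fun k => laxProfile κ γ ρs (hat k) 0, fun k => ⟨laxProfile_mem_D hρ (hhat k) _,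
      (tendsto_laxProfile ρs (hat k)).comp (tendsto_div_nhdsGT ht)⟩, ?_⟩
    refine Eq.trans (Finset.sum_congr rfl fun k _ => ?_) hsum
    rw [← momentum_laxProfile hρ (hhat k), momentum]

end Junction

end IsentropicGas

end

/-! ### Existence and uniqueness for the generalized Riemann problem -/

theorem mainTheorem1 (κ γ : ℝ) (hκ : 0 < κ) (hγ₁ : 1 < γ) (hγ₃ : γ < 3)
    (d : ℕ) (hd : 1 ≤ d) (A : Fin d → ℝ) (hA : ∀ k, 0 < A k)
    (hat : Fin d → IsentropicGas.State) (hhat : ∀ k, hat k ∈ IsentropicGas.D) :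
    ∃ (ρs : ℝ) (U : Fin d → ℝ → ℝ → IsentropicGas.State),
      IsentropicGas.IsGeneralizedRiemannSolution κ γ A hat ρs U ∧
      ∀ (ρs' : ℝ) (U' : Fin d → ℝ → ℝ → IsentropicGas.State),
        IsentropicGas.IsGeneralizedRiemannSolution κ γ A hat ρs' U' →
          ρs' = ρs ∧
          ∀ k, ∀ᵐ p : ℝ × ℝ ∂(volume.restrict (Ioi 0 ×ˢ Ioi 0)),
            U' k p.1 p.2 = U k p.1 p.2 := by
  have : Fact (0 < κ) := ⟨hκ⟩
  have : Fact (1 < γ) := ⟨hγ₁⟩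
  obtain ⟨ρs, hρ, hsum⟩ := IsentropicGas.exists_sum_traceFlux_eq_zero (κ := κ) (γ := γ) hA hhat
  refine ⟨ρs, _, IsentropicGas.isGeneralizedRiemannSolution_laxProfile hhat hρ hsum,
    fun ρs' U' hU' => ?_⟩
  obtain rfl : ρs' = ρs := IsentropicGas.sum_traceFlux_unique hd hA hhat hU'.density_nonneg hρ
    (hU'.sum_traceFlux hhat) hsum
  exact ⟨rfl, fun k => hU'.ae_eq_laxProfile k⟩
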